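/- Let $h>0$ and $\omega_0>1$ be real, and let $\mathbb H_h=\{\omega\in\mathbb C:\operatorname{Im}\omega>-h\}$. Let $H^2=H^2(\mathbb H_h)$ be the Hardy space of analytic functions $f$ on $\mathbb H_h$ with $\sup_{y>-h}\|f\|_{L^2(\mathbb R+iy)}<\infty$, with the norm $\|f\|=\|f\|_{L^2(\mathbb R-ih)}$ of the $L^2$ boundary data of $f$ on $\mathbb R-ih$. For $\omega\in\mathbb H_h$ put $$p_{\omega_0}(\omega)=\frac{i}{2\pi(\omega-\overline{\omega_0}+2ih)},\qquad (\mathcal K u)(\omega)=\int_{-1}^{1}p_x(\omega)\,u(x)\,dx ,$$ and for $\epsilon>0$ let $$D_h^0(\epsilon)=\sup\{|f(\omega_0)|:\ f\in H^2,\ \|f\|\le 1,\ \|f\|_{L^2(-1,1)}\le\epsilon\}.$$ **Theorem.** For every $\eta>0$ the equation $(\mathcal K+\eta)u=p_{\omega_0}$ has a unique solution $u=(\mathcal K+\eta)^{-1}p_{\omega_0}$ in $H^2$. If $0<\epsilon<\|p_{\omega_0}\|_{L^2(-1,1)}/\|p_{\omega_0}\|$, there is a unique $\eta=\eta(\epsilon,h,\omega_0)>0$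 such that $$\|(\mathcal K+\eta)^{-1}p_{\omega_0}\|_{L^2(-1,1)}=\epsilon\,\|(\mathcal K+\eta)^{-1}p_{\omega_0}\| .$$ Whenever $\epsilon>0$ and $\eta>0$ satisfy this equation, $u^*=(\mathcal K+\eta)^{-1}p_{\omega_0}$ is nonzero, $$D_h^0(\epsilon)=\frac{u^*(\omega_0)}{\|u^*\|},$$ and $f^*=u^*/\|u^*\|$ attains the supremum; every other maximizer equals $c f^*$ on $\mathbb H_h$ for a constant $c\in\mathbb C$ with $|c|=1$. -/

import Mathlib

open Filter Topology MeasureTheory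

noncomputable section

namespace HardyExtrapolation

/-- The half-plane `ℍ_h = {ω : Im ω > -h}`. -/
def halfPlane (h : ℝ) : Set ℂ := {ω : ℂ | -h < ω.im}

/-- The restriction `x ↦ f (x + i y)` of `f` to the horizontal line `ℝ + i y`. -/
def lineRestrict (f : ℂ → ℂ) (y : ℝ) : ℝ → ℂ := fun x => f ((x : ℂ) + (y : ℂ) * Complex.I)

/-- Membership in the Hardy class `H²(ℍ_h)`: `f` is analytic in `ℍ_h` and
`sup_{y > -h} ‖f‖_{L²(ℝ + i y)} < ∞`. A function on `ℍ_h` is represented by a function on `ℂ`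
whose values outside `ℍ_h` are irrelevant. -/
def MemHardy (h : ℝ) (f : ℂ → ℂ) : Prop :=
  DifferentiableOn ℂ f (halfPlane h) ∧
    (⨆ y ∈ Set.Ioi (-h), eLpNorm (lineRestrict f y) 2 volume) < ⊤

/-- `g ∈ L²(ℝ)` is the boundary data of `f` on the line `ℝ - i h`:
`f (· + i y) → g` in `L²(ℝ)` as `y ↓ -h`. -/
def IsBoundaryData (h : ℝ) (f : ℂ → ℂ) (g : ℝ → ℂ) : Prop :=
  MemLp g 2 volume ∧
    Tendsto (fun y : ℝ => eLpNorm (lineRestrict f y - g) 2 volume) (𝓝[>] (-h)) (𝓝 0)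

open Classical in
/-- The boundary data of `f` on `ℝ - i h` (unique up to a null set when it exists, as it does for
every `f ∈ H²(ℍ_h)`). -/
def boundaryData (h : ℝ) (f : ℂ → ℂ) : ℝ → ℂ :=
  if H : ∃ g : ℝ → ℂ, IsBoundaryData h f g then H.choose else 0

/-- The norm `‖f‖_{H²(ℍ_h)} = ‖f‖_{L²(ℝ - i h)}`. -/
def hardyNorm (h : ℝ) (f : ℂ → ℂ) : ℝ := (eLpNorm (boundaryData h f) 2 volume).toReal

/-- The norm does not depend on the choice of the boundary data. -/
theorem IsBoundaryData.hardyNorm_eq {h : ℝ} {f : ℂ → ℂ} {g : ℝ → ℂ}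
    (hfd : DifferentiableOn ℂ f (halfPlane h)) (hg : IsBoundaryData h f g) :
    hardyNorm h f = (eLpNorm g 2 volume).toReal := by
  have hex : ∃ g : ℝ → ℂ, IsBoundaryData h f g := ⟨g, hg⟩
  have hb : IsBoundaryData h f (boundaryData h f) := by
    unfold boundaryData; rw [dif_pos hex]; exact hex.choose_spec
  set b := boundaryData h f with hbdef
  have hm : ∀ y > -h, AEStronglyMeasurable (lineRestrict f y) volume := by
    intro y hy
    refine Continuous.aestronglyMeasurable ?_
    refine hfd.continuousOn.comp_continuous (by fun_prop) ?_
    intro x; simp [halfPlane]; linarith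
  have key : eLpNorm (b - g) 2 volume ≤ 0 := by
    have hlim : Tendsto (fun y : ℝ => eLpNorm (lineRestrict f y - b) 2 volume +
        eLpNorm (lineRestrict f y - g) 2 volume) (𝓝[>] (-h)) (𝓝 (0 + 0)) := hb.2.add hg.2
    rw [add_zero] at hlim
    refine ge_of_tendsto hlim ?_
    filter_upwards [self_mem_nhdsWithin] with y hy
    have : b - g = (b - lineRestrict f y) + (lineRestrict f y - g) := by abel
    rw [this]
    refine (eLpNorm_add_le (hb.1.1.sub (hm y hy)) ((hm y hy).sub hg.1.1) (by norm_num)).trans ?_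
    rw [eLpNorm_sub_comm b]
  have h0 : b - g =ᵐ[volume] 0 :=
    (eLpNorm_eq_zero_iff (hb.1.1.sub hg.1.1) (by norm_num)).1 (le_antisymm key bot_le)
  have h1 : b =ᵐ[volume] g := by
    filter_upwards [h0] with x hx
    exact sub_eq_zero.1 hx
  unfold hardyNorm
  rw [eLpNorm_congr_ae h1]

/-- The norm `‖f‖_{L²(-1,1)}`. -/
def bandNorm (f : ℂ → ℂ) : ℝ :=
  (eLpNorm (fun x : ℝ => f (x : ℂ)) 2 (volume.restrict (Set.Ioo (-1 : ℝ) 1))).toReal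

/-- `p_{ω₀}(ω) = i / (2π (ω - conj ω₀ + 2 i h))`. -/
def kernelFn (h : ℝ) (ω₀ ω : ℂ) : ℂ :=
  Complex.I / (2 * (Real.pi : ℂ) * (ω - (starRingEnd ℂ) ω₀ + 2 * Complex.I * (h : ℂ)))

/-- `(𝒦 u)(ω) = ∫_{-1}^{1} p_x(ω) u(x) dx`. -/
def integralOp (h : ℝ) (u : ℂ → ℂ) (ω : ℂ) : ℂ :=
  ∫ x in (-1 : ℝ)..1, kernelFn h (x : ℂ) ω * u (x : ℂ)

/-- `u ∈ H²(ℍ_h)` solves the Fredholm equation `(𝒦 + η) u = p_{ω₀}`, that is,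
`u = (𝒦 + η)⁻¹ p_{ω₀}`. -/
def IsFredholmSolution (h : ℝ) (ω₀ : ℂ) (η : ℝ) (u : ℂ → ℂ) : Prop :=
  MemHardy h u ∧ ∀ ω ∈ halfPlane h, integralOp h u ω + (η : ℂ) * u ω = kernelFn h ω₀ ω

/-- `f ∈ H²(ℍ_h)` with `‖f‖_{H²} ≤ 1` and `‖f‖_{L²(-1,1)} ≤ ε`. -/
def Admissible (h ε : ℝ) (f : ℂ → ℂ) : Prop :=
  MemHardy h f ∧ hardyNorm h f ≤ 1 ∧ bandNorm f ≤ ε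

/-- `D_h^0(ε)`, the supremum of `|f(ω₀)|` over admissible `f`. -/
def sharpBound (h : ℝ) (ω₀ : ℂ) (ε : ℝ) : ℝ :=
  sSup {r : ℝ | ∃ f : ℂ → ℂ, Admissible h ε f ∧ r = ‖f ω₀‖}

/-- `f` is admissible and `|f(ω₀)|` is largest among admissible functions. -/
def IsMaximizer (h : ℝ) (ω₀ : ℂ) (ε : ℝ) (f : ℂ → ℂ) : Prop :=
  Admissible h ε f ∧ ∀ g : ℂ → ℂ, Admissible h ε g → ‖g ω₀‖ ≤ ‖f ω₀‖

end HardyExtrapolation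

end

/-!
The proof turns the statement into one about operators between Hilbert spaces. The Hardy space
`hardySpace h` is realized as a closed subspace of `L²(ℝ)`, the space of boundary data, in which the
functions `p_w` are reproducing kernels: `f w = ⟪p_w, f⟫`. If `A` is the restriction of functions in
it to `L²(-1, 1)`, then `𝒦 = A† A`, so the Fredholm equation is the regularized normal equation
`(A† A + η) u = p`, `p = p_{ω₀}`, whose operator is bounded below by `η` and hence invertible.

*Optimality.* Pairing the equation with a competitor `f` gives
`⟪p, f⟫ = ⟪A u, A f⟫ + η ⟪u, f⟫`. If `‖A u‖ = ε ‖u‖`, the Cauchy-Schwarz inequality bounds this by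
`(ε² + η) ‖u‖`, with equality at `u / ‖u‖`; equality forces `f` to be a multiple of `u`
(`IsTikhonovSolution.norm_inner_le_max`, `IsTikhonovSolution.eq_smul_of_norm_inner_eq`).

*The parameter.* If two parameters gave the same ratio `ε`, their normalized solutions would be
maximizers of the same problem, so `p` would be an eigenvector of `A† A`, and then `ε = ‖A p‖ / ‖p‖`
(`IsTikhonovSolution.param_unique`). Existence is the intermediate value theorem
(`exists_param`): as `η → ∞`, `η u → p`, and as `η → 0` the ratio cannot stay above `ε`, since
otherwise `|⟪p, f⟫| ≤ C ‖A f‖` for all `f`. The powers of `p` contradict this, because `|p|` has a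
strict maximum over the real line at `ω₀ > 1` (`exists_band_small`).

*Hardy space theory.* The tool is that integrals of an integrable analytic function over horizontal
lines do not depend on the line (`integral_lineRestrict_eq`). Applied to `f(z) conj (f(conj z + 2im))`
it shows that the `L²` inner product of the restrictions of `f` to two lines is the squared norm
`N` on the line halfway between them. So `N` is midpoint convex and, being bounded, nonincreasing;
it has a limit at the boundary, and `‖f_y - f_z‖² = N(y) + N(z) - 2 N((y + z) / 2)` shows that the
restrictions converge in `L²` (`MemHardy.exists_tendsto_lineLp`). Applied to a quotient by `z - w` it
gives Cauchy's formula on lines inside the half-plane (`MemHardy.inner_cauchyLp_lineLp`), which passes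
to the boundary in the limit.
-/

noncomputable section

namespace HardyExtrapolation

/-! ### Integrals over horizontal lines -/

/-- Cauchy's theorem in a strip: the integrals of an integrable analytic function over the two
edges agree. The contributions of the vertical sides of a rectangle converge as the rectangle grows,
and are integrable as functions of the width, so they tend to zero. -/
theorem integral_lineRestrict_eq {G : ℂ → ℂ} {a b : ℝ} (hab : a ≤ b)
    (hd : DifferentiableOn ℂ G {z | z.im ∈ Set.Icc a b})
    (ha : Integrable (lineRestrict G a)) (hb : Integrable (lineRestrict G b))
    (hG : Integrable (fun p : ℝ × ℝ => lineRestrict G p.2 p.1)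
      (volume.prod (volume.restrict (Set.Ioc a b)))) :
    ∫ x, lineRestrict G a x = ∫ x, lineRestrict G b x := by
  set V : ℝ → ℂ := fun R => ∫ y in a..b, G ((R : ℂ) + (y : ℂ) * Complex.I) with hV
  have hVi : Integrable V := by
    have := hG.integral_prod_left
    simpa only [hV, intervalIntegral.integral_of_le hab, lineRestrict] using this
  have hWi : Integrable (fun R => V R - V (-R)) := hVi.sub hVi.comp_neg
  have hrect : ∀ R : ℝ, V R - V (-R) = Complex.I *
      ((∫ x in (-R)..R, lineRestrict G a x) - ∫ x in (-R)..R, lineRestrict G b x) := by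
    intro R
    have h1 := Complex.integral_boundary_rect_eq_zero_of_differentiableOn G
      (⟨-R, a⟩ : ℂ) (⟨R, b⟩ : ℂ) (hd.mono ?_)
    · simp only [smul_eq_mul] at h1
      simp only [hV, lineRestrict]
      linear_combination (-Complex.I) * h1 +
        ((∫ y in a..b, G ((R : ℂ) + (y : ℂ) * Complex.I)) -
          ∫ y in a..b, G (((-R : ℝ) : ℂ) + (y : ℂ) * Complex.I)) * Complex.I_sq
    · intro z hz
      have := (Complex.mem_reProdIm.1 hz).2
      rwa [Set.uIcc_of_le hab] at this
  have hlim : Tendsto (fun R => V R - V (-R)) atTop (𝓝 (Complex.I *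
      ((∫ x, lineRestrict G a x) - ∫ x, lineRestrict G b x))) := by
    simp_rw [hrect]
    exact ((intervalIntegral_tendsto_integral ha tendsto_neg_atTop_atBot tendsto_id).sub
      (intervalIntegral_tendsto_integral hb tendsto_neg_atTop_atBot tendsto_id)).const_mul _
  have h0 := IntegrableAtFilter.eq_zero_of_tendsto (μ := volume) (hWi.integrableAtFilter atTop)
    (fun s hs => by
      obtain ⟨c, hc⟩ := mem_atTop_sets.1 hs
      refine top_le_iff.1 ?_
      rw [← Real.volume_Ici (a := c)]
      exact measure_mono hc) hlim
  simpa [sub_eq_zero] using h0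

theorem aestronglyMeasurable_strip {F : ℂ → ℂ} {a b : ℝ}
    (hc : ContinuousOn F {z | z.im ∈ Set.Icc a b}) :
    AEStronglyMeasurable (fun p : ℝ × ℝ => lineRestrict F p.2 p.1)
      (volume.prod (volume.restrict (Set.Ioc a b))) := by
  have h1 : (volume : Measure ℝ).prod (volume.restrict (Set.Ioc a b)) =
      ((volume : Measure ℝ).prod volume).restrict (Set.univ ×ˢ Set.Ioc a b) := by
    rw [← Measure.prod_restrict, Measure.restrict_univ]
  rw [h1]
  refine ContinuousOn.aestronglyMeasurable ?_ (MeasurableSet.univ.prod measurableSet_Ioc)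
  refine hc.comp (by fun_prop) ?_
  rintro ⟨x, y⟩ ⟨-, hy⟩
  simpa using ⟨hy.1.le, hy.2⟩

theorem memLp_strip {F : ℂ → ℂ} {a b : ℝ} {M : ENNReal} (hM : M ≠ ⊤)
    (hc : ContinuousOn F {z | z.im ∈ Set.Icc a b})
    (hF : ∀ y ∈ Set.Icc a b, eLpNorm (lineRestrict F y) 2 volume ≤ M) :
    MemLp (fun p : ℝ × ℝ => lineRestrict F p.2 p.1) 2
      (volume.prod (volume.restrict (Set.Ioc a b))) := by
  have hm := aestronglyMeasurable_strip hc
  refine ⟨hm, ?_⟩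
  rw [eLpNorm_lt_top_iff_lintegral_rpow_enorm_lt_top (by norm_num) (by norm_num)]
  rw [lintegral_prod_symm _ (hm.enorm.pow_const _)]
  have hle : ∀ y ∈ Set.Ioc a b,
      ∫⁻ x, ‖lineRestrict F y x‖ₑ ^ (2 : ENNReal).toReal ≤ M ^ (2 : ℝ) := by
    intro y hy
    have h2 := hF y ⟨hy.1.le, hy.2⟩
    rw [eLpNorm_eq_lintegral_rpow_enorm_toReal (by norm_num) (by norm_num)] at h2
    have := ENNReal.rpow_le_rpow h2 (z := 2) (by norm_num)
    rw [← ENNReal.rpow_mul] at this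
    simpa using this
  calc _ ≤ ∫⁻ _ in Set.Ioc a b, M ^ (2 : ℝ) := setLIntegral_mono' measurableSet_Ioc hle
    _ < ⊤ := by
      rw [setLIntegral_const]
      exact ENNReal.mul_lt_top (ENNReal.rpow_lt_top_of_nonneg (by norm_num) hM) (by simp)

/-! ### Line restrictions of Hardy functions and boundary data -/

theorem isOpen_halfPlane (h : ℝ) : IsOpen (halfPlane h) :=
  isOpen_lt continuous_const Complex.continuous_im

theorem MemHardy.exists_bound {h : ℝ} {f : ℂ → ℂ} (hf : MemHardy h f) :
    ∃ M : ENNReal, M ≠ ⊤ ∧ ∀ y > -h, eLpNorm (lineRestrict f y) 2 volume ≤ M :=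
  ⟨_, hf.2.ne, fun y hy => le_iSup₂ (f := fun y (_ : y ∈ Set.Ioi (-h)) =>
    eLpNorm (lineRestrict f y) 2 volume) y hy⟩

theorem continuous_lineRestrict {h : ℝ} {f : ℂ → ℂ} (hf : ContinuousOn f (halfPlane h))
    {y : ℝ} (hy : -h < y) : Continuous (lineRestrict f y) :=
  hf.comp_continuous (by fun_prop) (fun x => by simpa [halfPlane] using hy)

theorem MemHardy.memLp {h : ℝ} {f : ℂ → ℂ} (hf : MemHardy h f) {y : ℝ} (hy : -h < y) :
    MemLp (lineRestrict f y) 2 volume := by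
  obtain ⟨M, hM, hb⟩ := hf.exists_bound
  exact ⟨(continuous_lineRestrict hf.1.continuousOn hy).aestronglyMeasurable,
    (hb y hy).trans_lt hM.lt_top⟩

open Classical in
/-- The restriction of `f` to the line `ℝ + i y` as an element of `L²(ℝ)`, with value `0` when the
restriction is not square integrable. -/
def lineLp (f : ℂ → ℂ) (y : ℝ) : Lp ℂ 2 (volume : Measure ℝ) :=
  if hm : MemLp (lineRestrict f y) 2 volume then hm.toLp else 0

theorem coeFn_lineLp {f : ℂ → ℂ} {y : ℝ} (hm : MemLp (lineRestrict f y) 2 volume) :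
    lineLp f y =ᵐ[volume] lineRestrict f y := by
  rw [lineLp, dif_pos hm]; exact hm.coeFn_toLp

theorem inner_lineLp {f g : ℂ → ℂ} {y z : ℝ} (hf : MemLp (lineRestrict f y) 2 volume)
    (hg : MemLp (lineRestrict g z) 2 volume) :
    inner ℂ (lineLp f y) (lineLp g z) =
      ∫ x, lineRestrict g z x * (starRingEnd ℂ) (lineRestrict f y x) := by
  rw [L2.inner_def]
  refine integral_congr_ae ?_
  filter_upwards [coeFn_lineLp hf, coeFn_lineLp hg] with x h1 h2
  rw [h1, h2]; simp

/-- The reflection `z ↦ conj (f (conj z + 2 i m))` across the line `ℝ + i m`. -/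
def reflect (f : ℂ → ℂ) (m : ℝ) (z : ℂ) : ℂ :=
  (starRingEnd ℂ) (f ((starRingEnd ℂ) z + 2 * (m : ℂ) * Complex.I))

theorem lineRestrict_reflect (f : ℂ → ℂ) (m y : ℝ) :
    lineRestrict (reflect f m) y = fun x => (starRingEnd ℂ) (lineRestrict f (2 * m - y) x) := by
  funext x
  simp only [lineRestrict, reflect]
  congr 2
  simp
  ring

theorem differentiableOn_reflect {h : ℝ} {f : ℂ → ℂ} (hf : DifferentiableOn ℂ f (halfPlane h))
    (m : ℝ) : DifferentiableOn ℂ (reflect f m) {z | z.im < 2 * m + h} := by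
  intro z hz
  have h1 : DifferentiableAt ℂ (fun w => f (w + 2 * (m : ℂ) * Complex.I))
      ((starRingEnd ℂ) z) := by
    refine DifferentiableAt.comp _ (hf.differentiableAt ?_) (by fun_prop)
    refine (isOpen_halfPlane h).mem_nhds ?_
    simp only [halfPlane, Set.mem_ofPred_eq] at hz ⊢
    simp; linarith
  have h2 := h1.conj_conj
  rw [Complex.conj_conj] at h2
  exact h2.differentiableWithinAt

/-- Inner products of line restrictions depend only on the midpoint of the two heights: the
function `f * reflect f m` is analytic in a strip, and its integrals over horizontal lines
agree. -/
theorem MemHardy.inner_lineLp_eq {h : ℝ} {f : ℂ → ℂ} (hf : MemHardy h f) {y d : ℝ}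
    (hy : -h < y) (hd : 0 ≤ d) :
    inner ℂ (lineLp f (y + 2 * d)) (lineLp f y) =
      inner ℂ (lineLp f (y + d)) (lineLp f (y + d)) := by
  obtain ⟨M, hM, hb⟩ := hf.exists_bound
  have hr : ∀ z, lineRestrict (fun w => f w * reflect f (y + d) w) z =
      lineRestrict f z * fun x => (starRingEnd ℂ) (lineRestrict f (2 * (y + d) - z) x) := by
    intro z
    rw [← lineRestrict_reflect]; rfl
  have hstar : ∀ g : ℝ → ℂ, MemLp g 2 volume → MemLp (fun x => (starRingEnd ℂ) (g x)) 2 volume :=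
    fun g hg => hg.star
  have hline : ∀ z, -h < z → z < 2 * (y + d) + h →
      Integrable (lineRestrict (fun w => f w * reflect f (y + d) w) z) := by
    intro z h1 h2
    rw [hr]
    exact MemLp.integrable_mul (hf.memLp h1) (hstar _ (hf.memLp (by linarith)))
  have hsub : {z : ℂ | z.im ∈ Set.Icc y (y + d)} ⊆ halfPlane h :=
    fun z hz => hy.trans_le hz.1
  have hsub' : {z : ℂ | z.im ∈ Set.Icc y (y + d)} ⊆ {z | z.im < 2 * (y + d) + h} :=
    fun z hz => lt_of_le_of_lt hz.2 (by linarith)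
  have hfd := hf.1.mono hsub
  have hgd := (differentiableOn_reflect hf.1 (y + d)).mono hsub'
  have key := integral_lineRestrict_eq (G := fun w => f w * reflect f (y + d) w)
    (a := y) (b := y + d) (by linarith) (hfd.mul hgd)
    (hline _ hy (by linarith)) (hline _ (by linarith) (by linarith)) ?_
  · rw [inner_lineLp (hf.memLp (by linarith)) (hf.memLp hy),
      inner_lineLp (hf.memLp (by linarith)) (hf.memLp (by linarith))]
    simp_rw [hr] at key
    have e1 : 2 * (y + d) - y = y + 2 * d := by ring
    have e2 : 2 * (y + d) - (y + d) = y + d := by ring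
    simpa only [e1, e2, Pi.mul_apply] using key
  · have hF := memLp_strip hM hfd.continuousOn (fun z hz => hb z (by linarith [hz.1]))
    have hG := memLp_strip hM hgd.continuousOn (fun z hz => by
      rw [lineRestrict_reflect]
      refine le_trans (le_of_eq ?_) (hb (2 * (y + d) - z) (by linarith [hz.2]))
      exact eLpNorm_congr_norm_ae (by simp))
    exact MemLp.integrable_mul hF hG

/-- Since the cross term is the squared norm on the line halfway, the distance of two line
restrictions is a second difference of squared norms. -/
theorem MemHardy.norm_lineLp_sub_sq {h : ℝ} {f : ℂ → ℂ} (hf : MemHardy h f) {y d : ℝ}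
    (hy : -h < y) (hd : 0 ≤ d) :
    ‖lineLp f y - lineLp f (y + 2 * d)‖ ^ 2 =
      ‖lineLp f y‖ ^ 2 + ‖lineLp f (y + 2 * d)‖ ^ 2 - 2 * ‖lineLp f (y + d)‖ ^ 2 := by
  rw [norm_sub_sq (𝕜 := ℂ), ← inner_conj_symm, hf.inner_lineLp_eq hy hd,
    RCLike.conj_re, inner_self_eq_norm_sq]
  ring

theorem MemHardy.norm_lineLp_le {h : ℝ} {f : ℂ → ℂ} (hf : MemHardy h f) :
    ∃ M : ℝ, ∀ y > -h, ‖lineLp f y‖ ^ 2 ≤ M := by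
  obtain ⟨M, hM, hb⟩ := hf.exists_bound
  refine ⟨M.toReal ^ 2, fun y hy => ?_⟩
  rw [lineLp, dif_pos (hf.memLp hy), Lp.norm_toLp]
  gcongr
  exact hb y hy

/-- The `L²` norm over the line `ℝ + i y` does not increase with `y`: its square is a bounded
function of `y` with nonnegative second differences. -/
theorem MemHardy.norm_lineLp_anti {h : ℝ} {f : ℂ → ℂ} (hf : MemHardy h f) {y z : ℝ}
    (hy : -h < y) (hyz : y ≤ z) : ‖lineLp f z‖ ≤ ‖lineLp f y‖ := by
  obtain ⟨M, hM⟩ := hf.norm_lineLp_le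
  obtain ⟨d, rfl⟩ : ∃ d, z = y + d := ⟨z - y, by ring⟩
  have hd : 0 ≤ d := by linarith
  -- an increase `N 1 > N 0` would make `N` grow at least linearly
  set N : ℕ → ℝ := fun k => ‖lineLp f (y + k * d)‖ ^ 2 with hN
  have hconv : ∀ k : ℕ, N (k + 1) - N k ≤ N (k + 2) - N (k + 1) := by
    intro k
    have h1 := hf.norm_lineLp_sub_sq (y := y + k * d) (d := d) (by nlinarith [k.cast_nonneg (α := ℝ)]) hd
    have h2 : y + k * d + 2 * d = y + ((k + 2 : ℕ) : ℝ) * d := by push_cast; ring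
    have h3 : y + k * d + d = y + ((k + 1 : ℕ) : ℝ) * d := by push_cast; ring
    rw [h2, h3] at h1
    have h4 := sq_nonneg ‖lineLp f (y + k * d) - lineLp f (y + ((k + 2 : ℕ) : ℝ) * d)‖
    simp only [hN]
    linarith
  have hstep : ∀ k : ℕ, N 1 - N 0 ≤ N (k + 1) - N k := by
    intro k
    induction k with
    | zero => simp
    | succ k ih => exact ih.trans (hconv k)
  have hlin : ∀ k : ℕ, N 0 + k * (N 1 - N 0) ≤ N k := by
    intro k
    induction k with
    | zero => simp
    | succ k ih => push_cast; linarith [hstep k]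
  have hle : N 1 ≤ N 0 := by
    by_contra! hlt
    obtain ⟨k, hk⟩ := exists_nat_gt ((M - N 0) / (N 1 - N 0))
    rw [div_lt_iff₀ (by linarith)] at hk
    have h1 : N k ≤ M := hM _ (by nlinarith [k.cast_nonneg (α := ℝ)])
    linarith [hlin k]
  refine (pow_le_pow_iff_left₀ (norm_nonneg _) (norm_nonneg _) two_ne_zero).1 ?_
  simpa [hN] using hle

/-- The restrictions to horizontal lines converge in `L²(ℝ)` at the boundary line. -/
theorem MemHardy.exists_tendsto_lineLp {h : ℝ} {f : ℂ → ℂ} (hf : MemHardy h f) :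
    ∃ g, Tendsto (lineLp f) (𝓝[>] (-h)) (𝓝 g) := by
  refine cauchy_map_iff_exists_tendsto.1 ?_
  obtain ⟨M, hM⟩ := hf.norm_lineLp_le
  set N : ℝ → ℝ := fun y => ‖lineLp f y‖ ^ 2 with hN
  have hanti : AntitoneOn N (Set.Ioi (-h)) := fun y hy z _ hyz => by
    have := hf.norm_lineLp_anti hy hyz
    simp only [hN]; gcongr
  have hbdd : BddAbove (N '' Set.Ioi (-h)) := ⟨M, by rintro _ ⟨y, hy, rfl⟩; exact hM y hy⟩
  set S := sSup (N '' Set.Ioi (-h)) with hS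
  have hle : ∀ y > -h, N y ≤ S := fun y hy => le_csSup hbdd ⟨y, hy, rfl⟩
  refine Metric.cauchy_iff.2 ⟨inferInstance, fun e he => ?_⟩
  obtain ⟨_, ⟨b, hb, rfl⟩, hbS⟩ := exists_lt_of_lt_csSup
    (s := N '' Set.Ioi (-h)) ⟨_, -h + 1, by simp, rfl⟩ (show S - e ^ 2 / 2 < S by nlinarith)
  refine ⟨lineLp f '' Set.Ioo (-h) b, image_mem_map (Ioo_mem_nhdsGT hb), ?_⟩
  have key : ∀ y z, -h < y → y ≤ z → z < b → dist (lineLp f y) (lineLp f z) < e := by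
    intro y z hy hyz hzb
    have h1 := hf.norm_lineLp_sub_sq (y := y) (d := (z - y) / 2) hy (by linarith)
    have h2 : y + 2 * ((z - y) / 2) = z := by ring
    rw [h2] at h1
    have h3 : N b ≤ N (y + (z - y) / 2) :=
      hanti (show -h < _ by linarith) hb (by linarith)
    have h4 := hle y hy
    have h5 := hle z (by linarith)
    rw [dist_eq_norm]
    refine lt_of_pow_lt_pow_left₀ 2 he.le ?_
    rw [h1]
    simp only [hN] at h3 h4 h5 hbS
    linarith
  rintro _ ⟨y, hy, rfl⟩ _ ⟨z, hz, rfl⟩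
  rcases le_total y z with hyz | hyz
  · exact key y z hy.1 hyz hz.2
  · rw [dist_comm]; exact key z y hz.1 hyz hy.2

/-! ### The Cauchy kernels in `L²(ℝ)` -/

/-- The function `s ↦ 1 / (s - c)` on the real line. -/
def cauchyFn (c : ℂ) (s : ℝ) : ℂ := ((s : ℂ) - c)⁻¹

theorem normSq_cauchyFn (c : ℂ) (s : ℝ) :
    ‖cauchyFn c s‖ ^ 2 = ((s - c.re) ^ 2 + c.im ^ 2)⁻¹ := by
  rw [cauchyFn, norm_inv, inv_pow, ← Complex.normSq_eq_norm_sq, Complex.normSq_apply]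
  simp
  ring

theorem integrable_normSq_cauchyFn {c : ℂ} (hc : c.im ≠ 0) :
    Integrable (fun s => ‖cauchyFn c s‖ ^ 2) ∧
      ∫ s, ‖cauchyFn c s‖ ^ 2 = Real.pi / |c.im| := by
  have e : (fun s => ‖cauchyFn c s‖ ^ 2) =
      fun s => (c.im ^ 2)⁻¹ * (fun t => (fun r : ℝ => (1 + r ^ 2)⁻¹) (t / c.im)) (s - c.re) := by
    funext s
    rw [normSq_cauchyFn]
    field_simp
    ring
  rw [e]
  constructor
  · exact ((integrable_inv_one_add_sq.comp_div hc).comp_sub_right c.re).const_mul _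
  · rw [integral_const_mul, integral_sub_right_eq_self
      (fun t => (fun r : ℝ => (1 + r ^ 2)⁻¹) (t / c.im)) c.re,
      Measure.integral_comp_div (fun r : ℝ => (1 + r ^ 2)⁻¹) c.im,
      integral_univ_inv_one_add_sq, ← sq_abs]
    have : |c.im| ≠ 0 := by simpa using hc
    rw [smul_eq_mul]
    field_simp

theorem continuous_cauchyFn {c : ℂ} (hc : c.im ≠ 0) : Continuous (cauchyFn c) := by
  refine Continuous.inv₀ (by fun_prop) (fun s h0 => hc ?_)
  have := congrArg Complex.im h0
  simpa using this

theorem memLp_cauchyFn {c : ℂ} (hc : c.im ≠ 0) : MemLp (cauchyFn c) 2 volume := by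
  rw [memLp_two_iff_integrable_sq_norm (continuous_cauchyFn hc).aestronglyMeasurable]
  exact (integrable_normSq_cauchyFn hc).1

open Classical in
/-- The function `s ↦ 1 / (s - c)` as an element of `L²(ℝ)`, with value `0` for real `c`. -/
def cauchyLp (c : ℂ) : Lp ℂ 2 (volume : Measure ℝ) :=
  if hc : c.im ≠ 0 then (memLp_cauchyFn hc).toLp else 0

theorem coeFn_cauchyLp {c : ℂ} (hc : c.im ≠ 0) : cauchyLp c =ᵐ[volume] cauchyFn c := by
  rw [cauchyLp, dif_pos hc]; exact (memLp_cauchyFn hc).coeFn_toLp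

theorem normSq_cauchyLp {c : ℂ} (hc : c.im ≠ 0) : ‖cauchyLp c‖ ^ 2 = Real.pi / |c.im| := by
  rw [← (integrable_normSq_cauchyFn hc).2]
  have h1 : (inner ℂ (cauchyLp c) (cauchyLp c)) = ((‖cauchyLp c‖ ^ 2 : ℝ) : ℂ) := by
    rw [inner_self_eq_norm_sq_to_K]; norm_cast
  have h2 : inner ℂ (cauchyLp c) (cauchyLp c) = ((∫ s, ‖cauchyFn c s‖ ^ 2 : ℝ) : ℂ) := by
    rw [L2.inner_def, ← integral_complex_ofReal]
    refine integral_congr_ae ?_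
    filter_upwards [coeFn_cauchyLp hc] with s hs
    rw [hs, inner_self_eq_norm_sq_to_K]; norm_cast
  exact_mod_cast h1.symm.trans h2

theorem conj_cauchyFn (c : ℂ) (s : ℝ) :
    (starRingEnd ℂ) (cauchyFn c s) = cauchyFn ((starRingEnd ℂ) c) s := by
  simp [cauchyFn]

theorem inner_cauchyLp {c : ℂ} (hc : c.im ≠ 0) (g : Lp ℂ 2 (volume : Measure ℝ)) :
    inner ℂ (cauchyLp c) g = ∫ s, g s * cauchyFn ((starRingEnd ℂ) c) s := by
  rw [L2.inner_def]
  refine integral_congr_ae ?_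
  filter_upwards [coeFn_cauchyLp hc] with s hs
  rw [hs, ← conj_cauchyFn]; simp

theorem norm_cauchyFn_sub_le {c c' : ℂ} (hc : c.im ≠ 0) (hc' : c'.im ≠ 0) (s : ℝ) :
    ‖cauchyFn c' s - cauchyFn c s‖ ≤ ‖c' - c‖ / |c'.im| * ‖cauchyFn c s‖ := by
  have h1 : ∀ {d : ℂ}, d.im ≠ 0 → (s : ℂ) - d ≠ 0 := fun hd h0 => hd (by
    simpa using congrArg Complex.im h0)
  have h2 : cauchyFn c' s - cauchyFn c s = (c' - c) * cauchyFn c' s * cauchyFn c s := by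
    have := h1 hc; have := h1 hc'
    simp only [cauchyFn]
    field_simp
    ring
  rw [h2, norm_mul, norm_mul, div_eq_mul_inv]
  gcongr
  rw [cauchyFn, norm_inv]
  gcongr
  simpa using Complex.abs_im_le_norm ((s : ℂ) - c')

theorem norm_cauchyLp_sub_le {c c' : ℂ} (hc : c.im ≠ 0) (hc' : c'.im ≠ 0) :
    ‖cauchyLp c' - cauchyLp c‖ ≤ ‖c' - c‖ / |c'.im| * ‖cauchyLp c‖ := by
  refine Lp.norm_le_mul_norm_of_ae_le_mul ?_
  filter_upwards [Lp.coeFn_sub (cauchyLp c') (cauchyLp c), coeFn_cauchyLp hc,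
    coeFn_cauchyLp hc'] with s h1 h2 h3
  rw [h1, Pi.sub_apply, h2, h3]
  exact norm_cauchyFn_sub_le hc hc' s

theorem continuousAt_cauchyLp {c : ℂ} (hc : c.im ≠ 0) : ContinuousAt cauchyLp c := by
  rw [ContinuousAt, tendsto_iff_norm_sub_tendsto_zero]
  have h1 : Tendsto (fun c' : ℂ => ‖c' - c‖ / |c'.im| * ‖cauchyLp c‖) (𝓝 c) (𝓝 0) := by
    have : ContinuousAt (fun c' : ℂ => ‖c' - c‖ / |c'.im| * ‖cauchyLp c‖) c := by
      refine ContinuousAt.mul (ContinuousAt.div (by fun_prop) ?_ (by simpa using hc))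
        continuousAt_const
      exact (Complex.continuous_im.abs).continuousAt
    simpa [ContinuousAt] using this
  refine squeeze_zero' (Eventually.of_forall fun _ => norm_nonneg _) ?_ h1
  filter_upwards [(Complex.continuous_im.continuousAt).eventually_ne hc] with c' hc'
  exact norm_cauchyLp_sub_le hc hc'

theorem lineRestrict_inv (c : ℂ) (y : ℝ) :
    lineRestrict (fun z => (z - c)⁻¹) y = cauchyFn (c - (y : ℂ) * Complex.I) := by
  funext s
  simp only [lineRestrict, cauchyFn]
  congr 1; ring

theorem eLpNorm_cauchyFn {c : ℂ} (hc : c.im ≠ 0) :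
    eLpNorm (cauchyFn c) 2 volume = ENNReal.ofReal (Real.sqrt (Real.pi / |c.im|)) := by
  rw [← normSq_cauchyLp hc, Real.sqrt_sq (norm_nonneg _), cauchyLp, dif_pos hc, Lp.norm_toLp,
    ENNReal.ofReal_toReal (memLp_cauchyFn hc).2.ne]

/-- An analytic function with bounded `L²` norms on the lines of a closed strip, divided by
`z - w` where `w` is a zero of the function, is integrable over the strip. -/
theorem integrable_dslope_strip {F : ℂ → ℂ} {a b : ℝ} {w : ℂ}
    (hw : F w = 0) (hc : ContinuousOn (dslope F w) {z | z.im ∈ Set.Icc a b})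
    (hF : MemLp (fun p : ℝ × ℝ => lineRestrict F p.2 p.1) 2
      (volume.prod (volume.restrict (Set.Ioc a b)))) :
    Integrable (fun p : ℝ × ℝ => lineRestrict (dslope F w) p.2 p.1)
      (volume.prod (volume.restrict (Set.Ioc a b))) := by
  set μ := (volume : Measure ℝ).prod (volume.restrict (Set.Ioc a b)) with hμ
  set e : ℂ := w.re + Complex.I with he
  have hei : e.im ≠ 0 := by simp [he]
  have hρ : MemLp (fun p : ℝ × ℝ => cauchyFn e p.1) 2 μ := (memLp_cauchyFn hei).comp_fst _
  obtain ⟨C, hC⟩ := ((isCompact_Icc (a := w.re - 1) (b := w.re + 1)).reProdIm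
    (isCompact_Icc (a := a) (b := b))).exists_bound_of_continuousOn
    (hc.mono fun z hz => (Complex.mem_reProdIm.1 hz).2)
  have hint : Integrable (fun p : ℝ × ℝ => 2 * |C| * (‖cauchyFn e p.1‖ * ‖cauchyFn e p.1‖) +
      2 * (‖lineRestrict F p.2 p.1‖ * ‖cauchyFn e p.1‖)) μ :=
    ((MemLp.integrable_mul hρ.norm hρ.norm).const_mul _).add
      ((MemLp.integrable_mul hF.norm hρ.norm).const_mul _)
  refine hint.mono' (aestronglyMeasurable_strip hc) ?_
  have hy : ∀ᵐ p ∂μ, p.2 ∈ Set.Ioc a b :=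
    Measure.quasiMeasurePreserving_snd.ae (ae_restrict_mem measurableSet_Ioc)
  filter_upwards [hy] with p hp
  obtain ⟨s, y⟩ := p
  have hsq : ‖cauchyFn e s‖ ^ 2 = ((s - w.re) ^ 2 + 1)⁻¹ := by
    rw [normSq_cauchyFn]; simp [he]
  have hpos : 0 ≤ ‖cauchyFn e s‖ := norm_nonneg _
  have hF0 : 0 ≤ ‖lineRestrict F y s‖ := norm_nonneg _
  -- near the line `Re z = Re w` the quotient is bounded by compactness of the rectangle; away from
  -- it `1 / |z - w|` is at most `2 |s - e|⁻¹`, a square integrable function of `s`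
  rcases le_or_gt |s - w.re| 1 with hs | hs
  · have h1 : ‖lineRestrict (dslope F w) y s‖ ≤ |C| := by
      refine (hC _ ?_).trans (le_abs_self C)
      rw [Complex.mem_reProdIm]
      obtain ⟨h2, h3⟩ := abs_le.1 hs
      simp only [Complex.add_re, Complex.ofReal_re, Complex.mul_re, Complex.I_re, Complex.I_im,
        Complex.ofReal_im, Complex.add_im, Complex.mul_im]
      exact ⟨⟨by linarith, by linarith⟩, ⟨by linarith [hp.1], by linarith [hp.2]⟩⟩
    have h2 : (1 : ℝ) / 2 ≤ ‖cauchyFn e s‖ ^ 2 := by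
      rw [hsq, one_div]
      refine inv_anti₀ (by positivity) ?_
      have := (sq_le_one_iff_abs_le_one _).2 hs
      linarith
    nlinarith [abs_nonneg C, mul_nonneg hF0 hpos]
  · have hne : (s : ℂ) + (y : ℂ) * Complex.I ≠ w := by
      rintro h0
      have : s = w.re := by simpa using congrArg Complex.re h0
      simp [this] at hs
      linarith
    have h1 : ‖lineRestrict (dslope F w) y s‖ =
        ‖((s : ℂ) + (y : ℂ) * Complex.I - w)⁻¹‖ * ‖lineRestrict F y s‖ := by
      simp [lineRestrict, dslope_of_ne _ hne, slope_def_module, hw]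
    have h2 : ‖((s : ℂ) + (y : ℂ) * Complex.I - w)⁻¹‖ ≤ 2 * ‖cauchyFn e s‖ := by
      have h3 : |s - w.re| ≤ ‖(s : ℂ) + (y : ℂ) * Complex.I - w‖ := by
        simpa using Complex.abs_re_le_norm ((s : ℂ) + (y : ℂ) * Complex.I - w)
      have h4 : |s - w.re|⁻¹ ≤ 2 * ‖cauchyFn e s‖ := by
        refine (pow_le_pow_iff_left₀ (by positivity) (by positivity) two_ne_zero).1 ?_
        rw [mul_pow, hsq, inv_pow, sq_abs, ← div_eq_mul_inv, inv_eq_one_div,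
          div_le_div_iff₀ (by rw [← sq_abs]; positivity) (by positivity)]
        have : 1 ≤ (s - w.re) ^ 2 := by
          rw [← sq_abs]; nlinarith
        linarith
      rw [norm_inv]
      exact (inv_anti₀ (by linarith) h3).trans h4
    rw [h1]
    have := mul_le_mul_of_nonneg_right h2 hF0
    have h5 : 0 ≤ 2 * |C| * (‖cauchyFn e s‖ * ‖cauchyFn e s‖) := by positivity
    simp only
    linarith

/-! ### Cauchy's formula and representation by boundary data -/

/-- Pairing with a Cauchy kernel divides by `z - w`; for a zero `w` of `F` the quotient is
`dslope F w`, which is analytic at `w` as well. -/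
theorem inner_cauchyLp_lineLp {F : ℂ → ℂ} {w : ℂ} {y : ℝ} (hy : y ≠ w.im)
    (hm : MemLp (lineRestrict F y) 2 volume) (hw : F w = 0) :
    inner ℂ (cauchyLp ((starRingEnd ℂ) w + y * Complex.I)) (lineLp F y) =
      ∫ s, lineRestrict (dslope F w) y s := by
  have him : ((starRingEnd ℂ) w + y * Complex.I).im ≠ 0 := by
    simp only [Complex.add_im, Complex.conj_im, Complex.mul_im, Complex.ofReal_re, Complex.I_im,
      Complex.ofReal_im, Complex.I_re]
    intro h0; apply hy; linarith
  rw [inner_cauchyLp him]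
  refine integral_congr_ae ?_
  filter_upwards [coeFn_lineLp hm] with s hs
  have hne : (s : ℂ) + (y : ℂ) * Complex.I ≠ w := by
    rintro rfl; simp at hy
  rw [hs]
  simp only [lineRestrict, dslope_of_ne _ hne, slope_def_field, hw, cauchyFn, sub_zero,
    div_eq_mul_inv]
  congr 2
  simp
  ring

theorem integrable_dslope_line {F : ℂ → ℂ} {w : ℂ} {y : ℝ} (hy : y ≠ w.im)
    (hm : MemLp (lineRestrict F y) 2 volume) (hw : F w = 0) :
    Integrable (lineRestrict (dslope F w) y) := by
  have him : (w - y * Complex.I).im ≠ 0 := by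
    simp only [Complex.sub_im, Complex.mul_im, Complex.ofReal_re, Complex.I_im,
      Complex.ofReal_im, Complex.I_re]
    intro h0; apply hy; linarith
  refine (MemLp.integrable_mul hm (memLp_cauchyFn him)).congr (Eventually.of_forall fun s => ?_)
  have hne : (s : ℂ) + (y : ℂ) * Complex.I ≠ w := by
    rintro rfl; simp at hy
  simp only [lineRestrict, dslope_of_ne _ hne, slope_def_field, hw, cauchyFn, sub_zero,
    div_eq_mul_inv, Pi.mul_apply]
  congr 2
  ring

/-- The Cauchy integral over a line vanishes for a function with a zero at the point in question:
the quotient is analytic, so the line can be moved up to infinity. -/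
theorem inner_cauchyLp_lineLp_eq_zero {h : ℝ} {F : ℂ → ℂ} {w : ℂ} {y₀ : ℝ} {M : ENNReal}
    (hM : M ≠ ⊤) (hd : DifferentiableOn ℂ F (halfPlane h)) (hy₀ : -h < y₀) (hyw : y₀ < w.im)
    (hF : ∀ y, y₀ ≤ y → eLpNorm (lineRestrict F y) 2 volume ≤ M) (hw : F w = 0) :
    inner ℂ (cauchyLp ((starRingEnd ℂ) w + y₀ * Complex.I)) (lineLp F y₀) = 0 := by
  have hm : ∀ y, y₀ ≤ y → MemLp (lineRestrict F y) 2 volume := fun y hy =>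
    ⟨(continuous_lineRestrict hd.continuousOn (hy₀.trans_le hy)).aestronglyMeasurable,
      (hF y hy).trans_lt hM.lt_top⟩
  have hds : DifferentiableOn ℂ (dslope F w) (halfPlane h) :=
    (Complex.differentiableOn_dslope ((isOpen_halfPlane h).mem_nhds (hy₀.trans hyw))).2 hd
  -- the pairing is constant above the height of `w`, and decays as the line moves up
  have hconst : ∀ y, w.im < y →
      inner ℂ (cauchyLp ((starRingEnd ℂ) w + y₀ * Complex.I)) (lineLp F y₀) =
      inner ℂ (cauchyLp ((starRingEnd ℂ) w + y * Complex.I)) (lineLp F y) := by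
    intro y hy
    have hsub : {z : ℂ | z.im ∈ Set.Icc y₀ y} ⊆ halfPlane h := fun z hz => hy₀.trans_le hz.1
    rw [inner_cauchyLp_lineLp hyw.ne (hm _ le_rfl) hw,
      inner_cauchyLp_lineLp hy.ne' (hm _ (by linarith)) hw]
    exact integral_lineRestrict_eq (by linarith) (hds.mono hsub)
      (integrable_dslope_line hyw.ne (hm _ le_rfl) hw)
      (integrable_dslope_line hy.ne' (hm _ (by linarith)) hw)
      (integrable_dslope_strip hw (hds.mono hsub).continuousOn
        (memLp_strip hM (hd.mono hsub).continuousOn fun z hz => hF z hz.1))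
  have hbound : ∀ y, w.im < y →
      ‖inner ℂ (cauchyLp ((starRingEnd ℂ) w + y₀ * Complex.I)) (lineLp F y₀)‖ ≤
        Real.sqrt (Real.pi / (y - w.im)) * M.toReal := by
    intro y hy
    rw [hconst y hy]
    refine (norm_inner_le_norm _ _).trans ?_
    have him : ((starRingEnd ℂ) w + y * Complex.I).im = y - w.im := by simp; ring
    have h1 : ‖cauchyLp ((starRingEnd ℂ) w + y * Complex.I)‖ =
        Real.sqrt (Real.pi / (y - w.im)) := by
      rw [← Real.sqrt_sq (norm_nonneg _), normSq_cauchyLp (by rw [him]; linarith), him,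
        abs_of_pos (by linarith)]
    rw [h1]
    gcongr
    rw [lineLp, dif_pos (hm y (by linarith)), Lp.norm_toLp]
    exact ENNReal.toReal_mono hM (hF y (by linarith))
  have hlim : Tendsto (fun y => Real.sqrt (Real.pi / (y - w.im)) * M.toReal) atTop (𝓝 0) := by
    have h1 : Tendsto (fun y => Real.pi / (y - w.im)) atTop (𝓝 0) :=
      Tendsto.const_div_atTop (tendsto_atTop_add_const_right _ _ tendsto_id) _
    simpa using (h1.sqrt).mul_const M.toReal
  have := ge_of_tendsto hlim ((eventually_gt_atTop w.im).mono hbound)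
  exact norm_le_zero_iff.1 this

/-- Cauchy's formula for the line `ℝ + i y₀`. The comparison function
`2 i b / (z - w + 2 i b)`, `b = Im w - y₀`, takes the value `1` at `w`, and its product with
`1 / (z - w)` on the line is a multiple of the Poisson kernel. -/
theorem MemHardy.inner_cauchyLp_lineLp {h : ℝ} {f : ℂ → ℂ} (hf : MemHardy h f) {w : ℂ} {y₀ : ℝ}
    (hy₀ : -h < y₀) (hyw : y₀ < w.im) :
    inner ℂ (cauchyLp ((starRingEnd ℂ) w + y₀ * Complex.I)) (lineLp f y₀) =
      2 * Real.pi * Complex.I * f w := by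
  obtain ⟨M, hM, hMb⟩ := hf.exists_bound
  set b : ℝ := w.im - y₀ with hb
  have hbpos : 0 < b := by linarith
  set c : ℂ := w - 2 * b * Complex.I with hc
  set a : ℂ := f w * (2 * b * Complex.I) with ha
  set F : ℂ → ℂ := fun z => f z - a * (z - c)⁻¹ with hF
  have hFl : ∀ y, lineRestrict F y = lineRestrict f y - a • cauchyFn (c - y * Complex.I) := by
    intro y; rw [← lineRestrict_inv]; rfl
  have hcim : ∀ y : ℝ, (c - y * Complex.I).im = y₀ - b - y := by
    intro y; simp [hc, hb]; ring
  have hcne : ∀ y : ℝ, y₀ ≤ y → (c - y * Complex.I).im ≠ 0 := by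
    intro y hy; rw [hcim]; linarith
  -- on the line `ℝ + i y₀` the comparison function and `1 / (z - w)` have conjugate poles
  have hc0 : c - y₀ * Complex.I = (starRingEnd ℂ) w + y₀ * Complex.I := by
    rw [hc, hb]
    apply Complex.ext
    · simp
    · simp; ring
  have hbI : (2 * b * Complex.I : ℂ) ≠ 0 := by
    simp [hbpos.ne']
  have hFw : F w = 0 := by
    have : w - c = 2 * b * Complex.I := by rw [hc]; ring
    simp only [hF, this, ha]
    rw [mul_assoc, mul_inv_cancel₀ hbI]; ring
  -- `c` lies below the line `ℝ + i y₀`, possibly inside `ℍ_h`, so `F` is analytic in a smaller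
  -- half-plane only
  have hFd : DifferentiableOn ℂ F (halfPlane (min h (b - y₀))) := by
    intro z hz
    have hz' : -min h (b - y₀) < z.im := hz
    refine ((hf.1.differentiableAt ((isOpen_halfPlane h).mem_nhds ?_)).sub
      ((DifferentiableAt.inv (by fun_prop) ?_).const_mul _)).differentiableWithinAt
    · show -h < z.im
      linarith [min_le_left h (b - y₀)]
    · intro h0
      have : z.im - c.im = 0 := by simpa using congrArg Complex.im h0
      have h2 : c.im = y₀ - b := by simpa using hcim 0
      linarith [min_le_right h (b - y₀)]
  set N : ENNReal := M + ‖a‖ₑ * ENNReal.ofReal (Real.sqrt (Real.pi / b)) with hN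
  have hNtop : N ≠ ⊤ := ENNReal.add_ne_top.2 ⟨hM, ENNReal.mul_ne_top (by simp) (by simp)⟩
  have hFb : ∀ y, y₀ ≤ y → eLpNorm (lineRestrict F y) 2 volume ≤ N := by
    intro y hy
    rw [hFl]
    refine (eLpNorm_sub_le (hf.memLp (by linarith)).1
      ((memLp_cauchyFn (hcne y hy)).1.const_smul a) (by norm_num)).trans ?_
    rw [eLpNorm_const_smul, eLpNorm_cauchyFn (hcne y hy)]
    refine add_le_add (hMb y (by linarith)) ?_
    gcongr
    rw [hcim, abs_of_neg (by linarith)]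
    linarith
  have hmin : -min h (b - y₀) < y₀ := by
    rcases min_choice h (b - y₀) with h1 | h1 <;> rw [h1] <;> linarith
  have key := inner_cauchyLp_lineLp_eq_zero hNtop hFd hmin hyw hFb hFw
  have hsub : lineLp F y₀ = lineLp f y₀ - a • cauchyLp ((starRingEnd ℂ) w + y₀ * Complex.I) := by
    rw [← hc0]
    have hmf := hf.memLp hy₀
    have hmc := memLp_cauchyFn (hcne y₀ le_rfl)
    have hmF : MemLp (lineRestrict F y₀) 2 volume := by
      rw [hFl]; exact hmf.sub (hmc.const_smul a)
    refine Lp.ext ?_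
    filter_upwards [coeFn_lineLp hmF, coeFn_lineLp hmf, coeFn_cauchyLp (hcne y₀ le_rfl),
      Lp.coeFn_sub (lineLp f y₀) (a • cauchyLp (c - y₀ * Complex.I)),
      Lp.coeFn_smul a (cauchyLp (c - y₀ * Complex.I))] with s h1 h2 h3 h4 h5
    rw [h1, h4, Pi.sub_apply, h5, h2, Pi.smul_apply, h3, hFl]; rfl
  rw [hsub, inner_sub_right, inner_smul_right, inner_self_eq_norm_sq_to_K, sub_eq_zero] at key
  rw [key]
  have h1 : (‖cauchyLp ((starRingEnd ℂ) w + y₀ * Complex.I)‖ : ℂ) ^ 2 = (Real.pi / b : ℝ) := by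
    rw [← hc0, ← Complex.ofReal_pow, normSq_cauchyLp (hcne y₀ le_rfl), hcim, abs_of_neg (by linarith)]
    congr 2; ring
  have hbc : (b : ℂ) ≠ 0 := by exact_mod_cast hbpos.ne'
  have h1' := h1
  simp only [RCLike.ofReal_eq_complex_ofReal] at h1' ⊢
  rw [h1', ha]
  push_cast
  field_simp

/-- The boundary values on `ℝ - i h` of the kernel `p_w`, as an element of `L²(ℝ)`. -/
def kernelLp (h : ℝ) (w : ℂ) : Lp ℂ 2 (volume : Measure ℝ) :=
  (Complex.I / (2 * Real.pi)) • cauchyLp ((starRingEnd ℂ) w - h * Complex.I)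

theorem im_boundary (h : ℝ) (w : ℂ) :
    ((starRingEnd ℂ) w - h * Complex.I).im = -(w.im + h) := by
  simp; ring

/-- A function in `H²(ℍ_h)` has boundary data, which represent the function through the kernels
`p_w`. -/
theorem MemHardy.exists_boundary {h : ℝ} {f : ℂ → ℂ} (hf : MemHardy h f) :
    ∃ g : Lp ℂ 2 (volume : Measure ℝ), Tendsto (lineLp f) (𝓝[>] (-h)) (𝓝 g) ∧
      ∀ w ∈ halfPlane h, f w = inner ℂ (kernelLp h w) g := by
  obtain ⟨g, hg⟩ := hf.exists_tendsto_lineLp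
  refine ⟨g, hg, fun w hw => ?_⟩
  have hw' : -h < w.im := hw
  have him : ((starRingEnd ℂ) w + ((-h : ℝ) : ℂ) * Complex.I).im ≠ 0 := by
    simp; linarith
  have h1 : Tendsto (fun y : ℝ => cauchyLp ((starRingEnd ℂ) w + y * Complex.I)) (𝓝[>] (-h))
      (𝓝 (cauchyLp ((starRingEnd ℂ) w + ((-h : ℝ) : ℂ) * Complex.I))) := by
    have h2 : ContinuousAt (fun y : ℝ => cauchyLp ((starRingEnd ℂ) w + y * Complex.I)) (-h) :=
      ContinuousAt.comp (f := fun y : ℝ => (starRingEnd ℂ) w + y * Complex.I)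
        (continuousAt_cauchyLp him) (by fun_prop)
    exact h2.tendsto.mono_left nhdsWithin_le_nhds
  have h3 := h1.inner hg (𝕜 := ℂ)
  have h4 : Tendsto (fun y : ℝ => inner ℂ (cauchyLp ((starRingEnd ℂ) w + y * Complex.I))
      (lineLp f y)) (𝓝[>] (-h)) (𝓝 (2 * Real.pi * Complex.I * f w)) := by
    refine tendsto_const_nhds.congr' ?_
    filter_upwards [Ioo_mem_nhdsGT hw'] with y hy
    exact (hf.inner_cauchyLp_lineLp hy.1 hy.2).symm
  have h5 := tendsto_nhds_unique h3 h4
  have e : (starRingEnd ℂ) w + ((-h : ℝ) : ℂ) * Complex.I =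
      (starRingEnd ℂ) w - h * Complex.I := by push_cast; ring
  rw [e] at h5
  have hpi : (Real.pi : ℂ) ≠ 0 := by exact_mod_cast Real.pi_ne_zero
  rw [kernelLp, inner_smul_left, h5]
  simp only [map_div₀, Complex.conj_I, map_mul, Complex.conj_ofReal]
  simp only [Complex.conj_ofNat]
  field_simp
  linear_combination f w * Complex.I_sq

theorem isBoundaryData_iff {h : ℝ} {f : ℂ → ℂ} (hf : MemHardy h f)
    (g : Lp ℂ 2 (volume : Measure ℝ)) :
    IsBoundaryData h f g ↔ Tendsto (lineLp f) (𝓝[>] (-h)) (𝓝 g) := by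
  rw [IsBoundaryData, and_iff_right (Lp.memLp g), tendsto_iff_edist_tendsto_0]
  refine tendsto_congr' ?_
  filter_upwards [self_mem_nhdsWithin] with y hy
  rw [Lp.edist_def]
  refine eLpNorm_congr_ae ?_
  filter_upwards [coeFn_lineLp (hf.memLp hy)] with s h1
  rw [Pi.sub_apply, Pi.sub_apply, h1]

/-! ### The Hardy space as a Hilbert space with reproducing kernels -/

theorem memHardy_of_bound {h : ℝ} {f : ℂ → ℂ} (hd : DifferentiableOn ℂ f (halfPlane h))
    {M : ENNReal} (hM : M ≠ ⊤) (hb : ∀ y > -h, eLpNorm (lineRestrict f y) 2 volume ≤ M) :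
    MemHardy h f :=
  ⟨hd, (iSup₂_le hb).trans_lt hM.lt_top⟩

theorem lineRestrict_congr {h : ℝ} {f g : ℂ → ℂ} (hfg : Set.EqOn f g (halfPlane h)) {y : ℝ}
    (hy : -h < y) : lineRestrict f y = lineRestrict g y := by
  funext s
  exact hfg (by simpa [halfPlane] using hy)

theorem lineLp_congr {h : ℝ} {f g : ℂ → ℂ} (hfg : Set.EqOn f g (halfPlane h)) {y : ℝ}
    (hy : -h < y) : lineLp f y = lineLp g y := by
  unfold lineLp
  rw [lineRestrict_congr hfg hy]

theorem MemHardy.congr {h : ℝ} {f g : ℂ → ℂ} (hf : MemHardy h f)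
    (hfg : Set.EqOn f g (halfPlane h)) : MemHardy h g := by
  obtain ⟨M, hM, hb⟩ := hf.exists_bound
  exact memHardy_of_bound (hf.1.congr hfg.symm) hM fun y hy => by
    rw [← lineRestrict_congr hfg hy]; exact hb y hy

theorem memHardy_zero (h : ℝ) : MemHardy h 0 :=
  memHardy_of_bound (differentiableOn_const 0) (M := 0) (by simp) fun y _ => by
    have : lineRestrict 0 y = 0 := rfl
    rw [this, eLpNorm_zero]

theorem MemHardy.add {h : ℝ} {f g : ℂ → ℂ} (hf : MemHardy h f) (hg : MemHardy h g) :
    MemHardy h (f + g) := by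
  obtain ⟨M, hM, hb⟩ := hf.exists_bound
  obtain ⟨N, hN, hc⟩ := hg.exists_bound
  refine memHardy_of_bound (hf.1.add hg.1) (ENNReal.add_ne_top.2 ⟨hM, hN⟩) fun y hy => ?_
  exact (eLpNorm_add_le (hf.memLp hy).1 (hg.memLp hy).1 (by norm_num)).trans
    (add_le_add (hb y hy) (hc y hy))

theorem MemHardy.const_smul {h : ℝ} {f : ℂ → ℂ} (hf : MemHardy h f) (c : ℂ) :
    MemHardy h (c • f) := by
  obtain ⟨M, hM, hb⟩ := hf.exists_bound
  refine memHardy_of_bound (hf.1.const_smul c) (ENNReal.mul_ne_top (a := ‖c‖ₑ) (by simp) hM)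
    fun y hy => ?_
  have : lineRestrict (c • f) y = c • lineRestrict f y := rfl
  rw [this, eLpNorm_const_smul]
  gcongr
  exact hb y hy

theorem lineLp_zero (y : ℝ) : lineLp 0 y = 0 := by
  rw [lineLp]
  split_ifs with h
  · exact MemLp.toLp_zero h
  · rfl

theorem lineLp_add {f g : ℂ → ℂ} {y : ℝ} (hf : MemLp (lineRestrict f y) 2 volume)
    (hg : MemLp (lineRestrict g y) 2 volume) :
    lineLp (f + g) y = lineLp f y + lineLp g y := by
  have hfg : MemLp (lineRestrict (f + g) y) 2 volume := hf.add hg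
  rw [lineLp, lineLp, lineLp, dif_pos hf, dif_pos hg, dif_pos hfg, ← MemLp.toLp_add]
  rfl

theorem lineLp_const_smul {f : ℂ → ℂ} {y : ℝ} (hf : MemLp (lineRestrict f y) 2 volume) (c : ℂ) :
    lineLp (c • f) y = c • lineLp f y := by
  have hcf : MemLp (lineRestrict (c • f) y) 2 volume := hf.const_smul c
  rw [lineLp, lineLp, dif_pos hf, dif_pos hcf, ← MemLp.toLp_const_smul]
  rfl

/-- The Cauchy transform of `g ∈ L²(ℝ)`, regarded as data on `ℝ - i h`. -/
def cauchyTransform (h : ℝ) (g : Lp ℂ 2 (volume : Measure ℝ)) (w : ℂ) : ℂ :=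
  inner ℂ (kernelLp h w) g

theorem cauchyTransform_add (h : ℝ) (g g' : Lp ℂ 2 (volume : Measure ℝ)) :
    cauchyTransform h (g + g') = cauchyTransform h g + cauchyTransform h g' := by
  funext w; simp [cauchyTransform, inner_add_right]

theorem cauchyTransform_smul (h : ℝ) (c : ℂ) (g : Lp ℂ 2 (volume : Measure ℝ)) :
    cauchyTransform h (c • g) = c • cauchyTransform h g := by
  funext w; simp [cauchyTransform, inner_smul_right]

/-- The Hardy space `H²(ℍ_h)` as a space of boundary data: those `g ∈ L²(ℝ)` whose Cauchy
transform is in the Hardy class and has boundary data `g`. Elements of the Hardy class correspond to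
elements of this space up to their irrelevant values outside `ℍ_h`. -/
def hardySpace (h : ℝ) : Submodule ℂ (Lp ℂ 2 (volume : Measure ℝ)) where
  carrier := {g | MemHardy h (cauchyTransform h g) ∧
    Tendsto (lineLp (cauchyTransform h g)) (𝓝[>] (-h)) (𝓝 g)}
  zero_mem' := by
    have h0 : cauchyTransform h 0 = 0 := by funext w; simp [cauchyTransform]
    refine ⟨by rw [h0]; exact memHardy_zero h, ?_⟩
    rw [h0]
    exact tendsto_const_nhds.congr fun y => (lineLp_zero y).symm
  add_mem' := by
    rintro g g' ⟨h1, h2⟩ ⟨h3, h4⟩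
    refine ⟨by rw [cauchyTransform_add]; exact h1.add h3, ?_⟩
    rw [cauchyTransform_add]
    refine (h2.add h4).congr' ?_
    filter_upwards [self_mem_nhdsWithin] with y hy
    exact (lineLp_add (h1.memLp hy) (h3.memLp hy)).symm
  smul_mem' := by
    rintro c g ⟨h1, h2⟩
    refine ⟨by rw [cauchyTransform_smul]; exact h1.const_smul c, ?_⟩
    rw [cauchyTransform_smul]
    refine (h2.const_smul c).congr' ?_
    filter_upwards [self_mem_nhdsWithin] with y hy
    exact (lineLp_const_smul (h1.memLp hy) c).symm

theorem tendsto_lineLp_congr {h : ℝ} {f f' : ℂ → ℂ} (hff : Set.EqOn f f' (halfPlane h))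
    {g : Lp ℂ 2 (volume : Measure ℝ)} (hg : Tendsto (lineLp f) (𝓝[>] (-h)) (𝓝 g)) :
    Tendsto (lineLp f') (𝓝[>] (-h)) (𝓝 g) := by
  refine hg.congr' ?_
  filter_upwards [self_mem_nhdsWithin] with y hy
  exact lineLp_congr hff hy

/-- Every function in the Hardy class comes from an element of the Hardy space. -/
theorem MemHardy.exists_hardySpace {h : ℝ} {f : ℂ → ℂ} (hf : MemHardy h f) :
    ∃ g ∈ hardySpace h, Tendsto (lineLp f) (𝓝[>] (-h)) (𝓝 g) ∧
      Set.EqOn f (cauchyTransform h g) (halfPlane h) := by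
  obtain ⟨g, hg, hrep⟩ := hf.exists_boundary
  have he : Set.EqOn f (cauchyTransform h g) (halfPlane h) := hrep
  exact ⟨g, ⟨hf.congr he, tendsto_lineLp_congr he hg⟩, hg, he⟩

/-- The Cauchy transform of an element of the Hardy space is bounded on horizontal lines by the
norm on the boundary. -/
theorem norm_lineLp_cauchyTransform_le {h : ℝ} {g : Lp ℂ 2 (volume : Measure ℝ)}
    (hg : g ∈ hardySpace h) {y : ℝ} (hy : -h < y) : ‖lineLp (cauchyTransform h g) y‖ ≤ ‖g‖ := by
  refine ge_of_tendsto hg.2.norm ?_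
  filter_upwards [Ioo_mem_nhdsGT hy] with z hz
  exact hg.1.norm_lineLp_anti hz.1 hz.2.le

theorem continuousOn_kernelLp (h : ℝ) : ContinuousOn (kernelLp h) (halfPlane h) := by
  intro w hw
  refine ContinuousAt.continuousWithinAt ?_
  have hw' : -h < w.im := hw
  refine ContinuousAt.const_smul (g := fun w : ℂ =>
    cauchyLp ((starRingEnd ℂ) w - h * Complex.I)) ?_
    (Complex.I / (2 * Real.pi) : ℂ)
  refine ContinuousAt.comp (f := fun w : ℂ => (starRingEnd ℂ) w - h * Complex.I)
    (continuousAt_cauchyLp ?_) ?_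
  · rw [im_boundary]; linarith
  · exact (Complex.continuous_conj.sub continuous_const).continuousAt

theorem cauchyTransform_tendsto (h : ℝ) {ι : Type*} {l : Filter ι}
    {g : ι → Lp ℂ 2 (volume : Measure ℝ)} {g₀ : Lp ℂ 2 (volume : Measure ℝ)}
    (hg : Tendsto g l (𝓝 g₀)) (w : ℂ) :
    Tendsto (fun i => cauchyTransform h (g i) w) l (𝓝 (cauchyTransform h g₀ w)) :=
  tendsto_const_nhds.inner hg

theorem eLpNorm_lineRestrict_eq {f : ℂ → ℂ} {y : ℝ} (hm : MemLp (lineRestrict f y) 2 volume) :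
    eLpNorm (lineRestrict f y) 2 volume = ‖lineLp f y‖ₑ := by
  rw [lineLp, dif_pos hm, Lp.enorm_def]
  exact (eLpNorm_congr_ae hm.coeFn_toLp).symm

/-- The Hardy class is stable under `L²` limits of boundary data: Cauchy transforms converge locally
uniformly, and Fatou's lemma bounds the norms on lines. -/
theorem memHardy_of_mem_closure {h : ℝ} {g : Lp ℂ 2 (volume : Measure ℝ)}
    (hg : g ∈ closure (hardySpace h : Set (Lp ℂ 2 (volume : Measure ℝ)))) :
    MemHardy h (cauchyTransform h g) ∧ ∀ y > -h, ‖lineLp (cauchyTransform h g) y‖ ≤ ‖g‖ := by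
  obtain ⟨G, hG, hlim⟩ := mem_closure_iff_seq_limit.1 hg
  have hd : DifferentiableOn ℂ (cauchyTransform h g) (halfPlane h) := by
    refine TendstoLocallyUniformlyOn.differentiableOn (φ := atTop)
      (F := fun n => cauchyTransform h (G n)) ?_ (Eventually.of_forall fun n => (hG n).1.1)
      (isOpen_halfPlane h)
    rw [tendstoLocallyUniformlyOn_iff_forall_isCompact (isOpen_halfPlane h)]
    intro K hK hKc
    obtain ⟨C, hC⟩ := hKc.exists_bound_of_continuousOn ((continuousOn_kernelLp h).mono hK)
    rw [Metric.tendstoUniformlyOn_iff]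
    intro e he
    have h1 : Tendsto (fun n => C * ‖g - G n‖) atTop (𝓝 0) := by
      have := (tendsto_iff_norm_sub_tendsto_zero.1 hlim).const_mul C
      simpa only [mul_zero, norm_sub_rev] using this
    filter_upwards [h1.eventually_lt_const he] with n hn w hw
    refine lt_of_le_of_lt ?_ hn
    rw [dist_eq_norm, cauchyTransform, cauchyTransform, ← inner_sub_right]
    refine (norm_inner_le_norm _ _).trans ?_
    gcongr
    exact hC w hw
  have hb : ∀ y > -h, eLpNorm (lineRestrict (cauchyTransform h g) y) 2 volume ≤ ‖g‖ₑ := by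
    intro y hy
    have hle : ∀ n, eLpNorm (lineRestrict (cauchyTransform h (G n)) y) 2 volume ≤ ‖G n‖ₑ :=
      fun n => by
        rw [eLpNorm_lineRestrict_eq ((hG n).1.memLp hy)]
        exact enorm_le_iff_norm_le.2 (norm_lineLp_cauchyTransform_le (hG n) hy)
    refine (Lp.eLpNorm_lim_le_liminf_eLpNorm
      (f := fun n => lineRestrict (cauchyTransform h (G n)) y)
      (fun n => ((hG n).1.memLp hy).1) _
      (Eventually.of_forall fun s => cauchyTransform_tendsto h hlim _)).trans ?_
    refine (liminf_le_liminf (Eventually.of_forall hle)).trans ?_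
    rw [hlim.enorm.liminf_eq]
  have hmem := memHardy_of_bound hd (by simp) hb
  refine ⟨hmem, fun y hy => ?_⟩
  rw [← enorm_le_iff_norm_le, ← eLpNorm_lineRestrict_eq (hmem.memLp hy)]
  exact hb y hy

theorem isClosed_hardySpace (h : ℝ) :
    IsClosed (hardySpace h : Set (Lp ℂ 2 (volume : Measure ℝ))) := by
  refine isClosed_of_closure_subset fun g hg => ?_
  obtain ⟨hmem, -⟩ := memHardy_of_mem_closure hg
  refine ⟨hmem, ?_⟩
  rw [Metric.tendsto_nhds]
  intro e he
  obtain ⟨G, hG, hgG⟩ := Metric.mem_closure_iff.1 hg (e / 3) (by linarith)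
  have hsub : g - G ∈ closure (hardySpace h : Set (Lp ℂ 2 (volume : Measure ℝ))) :=
    (hardySpace h).topologicalClosure.sub_mem hg (subset_closure hG)
  obtain ⟨hmem', hle⟩ := memHardy_of_mem_closure hsub
  filter_upwards [Metric.tendsto_nhds.1 hG.2 (e / 3) (by linarith), self_mem_nhdsWithin]
    with y h1 hy
  have h2 : lineLp (cauchyTransform h g) y =
      lineLp (cauchyTransform h (g - G)) y + lineLp (cauchyTransform h G) y := by
    rw [← lineLp_add (hmem'.memLp hy) (hG.1.memLp hy), ← cauchyTransform_add, sub_add_cancel]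
  have h3 := hle y hy
  rw [dist_eq_norm] at hgG h1 ⊢
  calc ‖lineLp (cauchyTransform h g) y - g‖
      = ‖lineLp (cauchyTransform h (g - G)) y + (lineLp (cauchyTransform h G) y - G) - (g - G)‖ := by
        rw [h2]; congr 1; abel
    _ ≤ ‖lineLp (cauchyTransform h (g - G)) y‖ + ‖lineLp (cauchyTransform h G) y - G‖ +
        ‖g - G‖ := (norm_sub_le _ _).trans (by gcongr; exact norm_add_le _ _)
    _ < e := by linarith

/-- An element of the Hardy space whose Cauchy transform vanishes on the half-plane is zero. -/
theorem eq_zero_of_cauchyTransform {h : ℝ} {g : Lp ℂ 2 (volume : Measure ℝ)}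
    (hg : g ∈ hardySpace h) (h0 : ∀ w ∈ halfPlane h, cauchyTransform h g w = 0) : g = 0 := by
  have h1 := tendsto_lineLp_congr (f' := 0) (fun w hw => h0 w hw) hg.2
  exact tendsto_nhds_unique h1 (tendsto_const_nhds.congr fun y => (lineLp_zero y).symm)

theorem kernelFn_eq (h : ℝ) (w : ℂ) :
    kernelFn h w = (Complex.I / (2 * Real.pi)) •
      fun z => (z - ((starRingEnd ℂ) w - 2 * h * Complex.I))⁻¹ := by
  funext z
  simp only [kernelFn, Pi.smul_apply, smul_eq_mul, div_eq_mul_inv, mul_inv, mul_assoc]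
  congr 4
  ring

theorem lineRestrict_kernelFn (h : ℝ) (w : ℂ) (y : ℝ) :
    lineRestrict (kernelFn h w) y = (Complex.I / (2 * Real.pi)) •
      cauchyFn ((starRingEnd ℂ) w - 2 * h * Complex.I - y * Complex.I) := by
  rw [← lineRestrict_inv, kernelFn_eq]; rfl

theorem im_kernel_pole (h : ℝ) (w : ℂ) (y : ℝ) :
    ((starRingEnd ℂ) w - 2 * h * Complex.I - y * Complex.I).im = -((w.im + h) + (y + h)) := by
  simp; ring

theorem memHardy_kernelFn {h : ℝ} {w : ℂ} (hw : w ∈ halfPlane h) : MemHardy h (kernelFn h w) := by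
  have hw' : -h < w.im := hw
  rw [kernelFn_eq]
  refine MemHardy.const_smul (memHardy_of_bound ?_ (M := ENNReal.ofReal
    (Real.sqrt (Real.pi / (w.im + h)))) (by simp) fun y hy => ?_) _
  · intro z hz
    have hz' : -h < z.im := hz
    refine (DifferentiableAt.inv (by fun_prop) fun h0 => ?_).differentiableWithinAt
    have h1 := congrArg Complex.im h0
    simp at h1
    linarith
  · have him := im_kernel_pole h w y
    have hy' : -h < y := hy
    rw [lineRestrict_inv, eLpNorm_cauchyFn (by rw [him]; linarith), him, abs_of_neg (by linarith)]
    have : 0 < w.im + h := by linarith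
    gcongr
    linarith

theorem tendsto_lineLp_kernelFn {h : ℝ} {w : ℂ} (hw : w ∈ halfPlane h) :
    Tendsto (lineLp (kernelFn h w)) (𝓝[>] (-h)) (𝓝 (kernelLp h w)) := by
  have hw' : -h < w.im := hw
  have e : (starRingEnd ℂ) w - 2 * h * Complex.I - ((-h : ℝ) : ℂ) * Complex.I =
      (starRingEnd ℂ) w - h * Complex.I := by push_cast; ring
  have h1 : ContinuousAt (fun y : ℝ =>
      cauchyLp ((starRingEnd ℂ) w - 2 * h * Complex.I - y * Complex.I)) (-h) := by
    refine ContinuousAt.comp (f := fun y : ℝ =>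
      (starRingEnd ℂ) w - 2 * h * Complex.I - y * Complex.I) (continuousAt_cauchyLp ?_)
      (by fun_prop)
    rw [e, im_boundary]; linarith
  have h2 := (h1.tendsto.mono_left (nhdsWithin_le_nhds (s := Set.Ioi (-h)))).const_smul
    (Complex.I / (2 * Real.pi))
  rw [e] at h2
  refine h2.congr' ?_
  filter_upwards [self_mem_nhdsWithin] with y hy
  have hy' : -h < y := hy
  have him : ((starRingEnd ℂ) w - 2 * h * Complex.I - y * Complex.I).im ≠ 0 := by
    rw [im_kernel_pole]; linarith
  refine Lp.ext ?_
  filter_upwards [coeFn_lineLp ((memHardy_kernelFn hw).memLp hy'), coeFn_cauchyLp him,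
    Lp.coeFn_smul (Complex.I / (2 * Real.pi) : ℂ)
      (cauchyLp ((starRingEnd ℂ) w - 2 * h * Complex.I - y * Complex.I))] with s h3 h4 h5
  rw [h3, h5, Pi.smul_apply, h4, lineRestrict_kernelFn]; rfl

/-- The kernels `p_w` are the reproducing kernels of the Hardy space. -/
theorem kernelLp_mem {h : ℝ} {w : ℂ} (hw : w ∈ halfPlane h) :
    kernelLp h w ∈ hardySpace h ∧
      Set.EqOn (kernelFn h w) (cauchyTransform h (kernelLp h w)) (halfPlane h) := by
  obtain ⟨g, hg, hlim, he⟩ := (memHardy_kernelFn hw).exists_hardySpace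
  obtain rfl := tendsto_nhds_unique hlim (tendsto_lineLp_kernelFn hw)
  exact ⟨hg, he⟩

theorem hardyNorm_eq_norm {h : ℝ} {f : ℂ → ℂ} (hf : MemHardy h f)
    {g : Lp ℂ 2 (volume : Measure ℝ)} (hg : Tendsto (lineLp f) (𝓝[>] (-h)) (𝓝 g)) :
    hardyNorm h f = ‖g‖ := by
  rw [((isBoundaryData_iff hf g).2 hg).hardyNorm_eq hf.1, Lp.norm_def]

/-! ### Regularized normal equations in Hilbert space -/

section Tikhonov

open ContinuousLinearMap (adjoint)

variable {E F : Type*} [NormedAddCommGroup E] [InnerProductSpace ℂ E] [CompleteSpace E]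
  [NormedAddCommGroup F] [InnerProductSpace ℂ F] [CompleteSpace F]

/-- `u` solves the regularized normal equation `(A† A + η) u = p`. -/
def IsTikhonovSolution (A : E →L[ℂ] F) (p : E) (η : ℝ) (u : E) : Prop :=
  adjoint A (A u) + (η : ℂ) • u = p

variable {A : E →L[ℂ] F} {p : E} {η : ℝ} {u : E}

theorem IsTikhonovSolution.inner_eq (hu : IsTikhonovSolution A p η u) (f : E) :
    inner ℂ p f = inner ℂ (A u) (A f) + (η : ℂ) * inner ℂ u f := by
  rw [← hu, inner_add_left, ContinuousLinearMap.adjoint_inner_left, inner_smul_left,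
    Complex.conj_ofReal]

theorem IsTikhonovSolution.inner_self_eq (hu : IsTikhonovSolution A p η u) :
    inner ℂ p u = ((‖A u‖ ^ 2 + η * ‖u‖ ^ 2 : ℝ) : ℂ) := by
  rw [hu.inner_eq, inner_self_eq_norm_sq_to_K, inner_self_eq_norm_sq_to_K]
  push_cast; rfl

theorem IsTikhonovSolution.norm_inner_le (hη : 0 < η) (hu : IsTikhonovSolution A p η u) (f : E) :
    ‖inner ℂ p f‖ ≤ ‖A u‖ * ‖A f‖ + η * ‖inner ℂ u f‖ := by
  rw [hu.inner_eq]
  refine (norm_add_le _ _).trans (add_le_add (norm_inner_le_norm _ _) ?_)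
  rw [norm_mul, Complex.norm_real, Real.norm_of_nonneg hη.le]

theorem IsTikhonovSolution.norm_sq_le (hη : 0 < η) (hu : IsTikhonovSolution A p η u) :
    ‖A u‖ ^ 2 + η * ‖u‖ ^ 2 ≤ ‖p‖ * ‖u‖ := by
  have h1 := norm_inner_le_norm (𝕜 := ℂ) p u
  rw [hu.inner_self_eq, Complex.norm_real, Real.norm_of_nonneg (by positivity)] at h1
  exact h1

theorem IsTikhonovSolution.norm_le (hη : 0 < η) (hu : IsTikhonovSolution A p η u) :
    η * ‖u‖ ≤ ‖p‖ := by
  have h1 := hu.norm_sq_le hη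
  rcases (norm_nonneg u).eq_or_lt with h0 | h0
  · rw [← h0]; simp
  · nlinarith [sq_nonneg ‖A u‖]

theorem exists_isTikhonovSolution (A : E →L[ℂ] F) (p : E) (hη : 0 < η) :
    ∃ u, IsTikhonovSolution A p η u := by
  set T : E →L[ℂ] E := adjoint A ∘L A + (η : ℂ) • ContinuousLinearMap.id ℂ E with hT
  have hunit : IsUnit T := by
    refine ContinuousLinearMap.isUnit_of_forall_le_norm_inner_map T (c := ⟨η, hη.le⟩) hη
      fun x => ?_
    have hx : IsTikhonovSolution A (T x) η x := rfl
    rw [hx.inner_self_eq, Complex.norm_real, Real.norm_of_nonneg (by positivity)]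
    show ‖x‖ ^ 2 * η ≤ _
    nlinarith [sq_nonneg ‖A x‖]
  exact (ContinuousLinearMap.isUnit_iff_bijective.1 hunit).2 p

theorem IsTikhonovSolution.norm_sub_le {η' : ℝ} {u' : E} (hη : 0 < η)
    (hu : IsTikhonovSolution A p η u) (hu' : IsTikhonovSolution A p η' u') :
    η * ‖u - u'‖ ≤ |η' - η| * ‖u'‖ := by
  have h1 : IsTikhonovSolution A (((η' - η : ℝ) : ℂ) • u') η (u - u') := by
    have h2 : adjoint A (A u) + (η : ℂ) • u = adjoint A (A u') + (η' : ℂ) • u' := hu.trans hu'.symm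
    rw [IsTikhonovSolution, map_sub, map_sub]
    rw [← sub_eq_zero] at h2 ⊢
    rw [← h2]
    push_cast
    module
  have := h1.norm_le hη
  rwa [norm_smul, Complex.norm_real, Real.norm_eq_abs] at this

theorem IsTikhonovSolution.unique {u' : E} (hη : 0 < η)
    (hu : IsTikhonovSolution A p η u) (hu' : IsTikhonovSolution A p η u') : u = u' := by
  have := hu.norm_sub_le hη hu'
  simp only [sub_self, abs_zero, zero_mul] at this
  have h2 : ‖u - u'‖ ≤ 0 := by nlinarith
  exact sub_eq_zero.1 (norm_le_zero_iff.1 h2)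

theorem IsTikhonovSolution.ne_zero (hp : p ≠ 0) (hu : IsTikhonovSolution A p η u) : u ≠ 0 := by
  rintro rfl
  exact hp (by simpa [IsTikhonovSolution] using hu.symm)

variable {ε : ℝ}

/-- If `‖A u‖ = ε ‖u‖`, so that `u / ‖u‖` lies on the corner of the constraints `‖f‖ ≤ 1` and
`‖A f‖ ≤ ε`, then `(ε² + η) ‖u‖`, which is the value at `u / ‖u‖`, bounds `|⟪p, f⟫|`. -/
theorem IsTikhonovSolution.norm_inner_le_max (hη : 0 < η) (hε : 0 ≤ ε)
    (hu : IsTikhonovSolution A p η u) (hcorner : ‖A u‖ = ε * ‖u‖) {f : E} (hf : ‖f‖ ≤ 1)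
    (hAf : ‖A f‖ ≤ ε) : ‖inner ℂ p f‖ ≤ (ε ^ 2 + η) * ‖u‖ := by
  calc ‖inner ℂ p f‖ ≤ ‖A u‖ * ‖A f‖ + η * ‖inner ℂ u f‖ := hu.norm_inner_le hη f
    _ ≤ (ε * ‖u‖) * ε + η * (‖u‖ * 1) := by
      rw [hcorner]
      gcongr
      exact (norm_inner_le_norm _ _).trans (by gcongr)
    _ = _ := by ring

theorem IsTikhonovSolution.inner_self_corner
    (hu : IsTikhonovSolution A p η u) (hcorner : ‖A u‖ = ε * ‖u‖) :
    inner ℂ p u = (((ε ^ 2 + η) * ‖u‖ ^ 2 : ℝ) : ℂ) := by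
  rw [hu.inner_self_eq, hcorner]; congr 1; ring

/-- Equality in the bound forces equality in the Cauchy-Schwarz inequality for `⟪u, f⟫`. -/
theorem IsTikhonovSolution.eq_smul_of_norm_inner_eq (hη : 0 < η) (hε : 0 ≤ ε) (hu0 : u ≠ 0)
    (hu : IsTikhonovSolution A p η u) (hcorner : ‖A u‖ = ε * ‖u‖) {f : E} (hf : ‖f‖ ≤ 1)
    (hAf : ‖A f‖ ≤ ε) (hmax : (ε ^ 2 + η) * ‖u‖ ≤ ‖inner ℂ p f‖) :
    ∃ c : ℂ, ‖c‖ = 1 ∧ f = (c / ‖u‖) • u := by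
  have hupos : 0 < ‖u‖ := norm_pos_iff.2 hu0
  have h1 := hu.norm_inner_le hη f
  have h2 : ‖A u‖ * ‖A f‖ ≤ ε * ‖u‖ * ε := by rw [hcorner]; gcongr
  have h3 : ‖u‖ ≤ ‖inner ℂ u f‖ := by nlinarith
  have h4 := norm_inner_le_norm (𝕜 := ℂ) u f
  have hf1 : ‖f‖ = 1 := le_antisymm hf (by nlinarith)
  have hf0 : f ≠ 0 := by rintro rfl; simp at hf1
  obtain ⟨r, -, hr⟩ := (norm_inner_eq_norm_iff (𝕜 := ℂ) hu0 hf0).1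
    (le_antisymm h4 (by rw [hf1]; linarith))
  have huc : (‖u‖ : ℂ) ≠ 0 := by exact_mod_cast hupos.ne'
  refine ⟨r * ‖u‖, ?_, by rw [mul_div_cancel_right₀ _ huc]; exact hr⟩
  rw [norm_mul, Complex.norm_real, Real.norm_of_nonneg hupos.le, ← norm_smul, ← hr, hf1]

/-- The regularization parameter is determined by the ratio `‖A u‖ / ‖u‖`, unless `p` is an
eigenvector of `A† A`. -/
theorem IsTikhonovSolution.param_unique {η' : ℝ} {u' : E} (hη : 0 < η) (hη' : 0 < η') (hε : 0 ≤ ε)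
    (hp : ε * ‖p‖ < ‖A p‖)
    (hu : IsTikhonovSolution A p η u) (hcorner : ‖A u‖ = ε * ‖u‖)
    (hu' : IsTikhonovSolution A p η' u') (hcorner' : ‖A u'‖ = ε * ‖u'‖) : η = η' := by
  have hp0 : p ≠ 0 := by rintro rfl; simp at hp
  have hu0 := norm_pos_iff.2 (hu.ne_zero hp0)
  have hu0' := norm_pos_iff.2 (hu'.ne_zero hp0)
  -- each normalized solution is a competitor for the other one
  have hcomp : ∀ {η η' : ℝ} {u u' : E}, 0 < η → 0 < η' → 0 < ‖u'‖ →
      IsTikhonovSolution A p η u → ‖A u‖ = ε * ‖u‖ →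
      IsTikhonovSolution A p η' u' → ‖A u'‖ = ε * ‖u'‖ →
      (ε ^ 2 + η') * ‖u'‖ ≤ (ε ^ 2 + η) * ‖u‖ := by
    intro η η' u u' hη hη' hu0' hu hc hu' hc'
    have h1 := hu.norm_inner_le hη u'
    rw [hu'.inner_self_corner hc', Complex.norm_real, Real.norm_of_nonneg (by positivity), hc,
      hc'] at h1
    have h2 := norm_inner_le_norm (𝕜 := ℂ) u u'
    have h3 : (ε ^ 2 + η') * ‖u'‖ * ‖u'‖ ≤ (ε ^ 2 + η) * ‖u‖ * ‖u'‖ := by nlinarith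
    exact le_of_mul_le_mul_right h3 hu0'
  have heq : (ε ^ 2 + η') * ‖u'‖ = (ε ^ 2 + η) * ‖u‖ :=
    le_antisymm (hcomp hη hη' hu0' hu hcorner hu' hcorner')
      (hcomp hη' hη hu0 hu' hcorner' hu hcorner)
  have hn' : ‖((‖u'‖⁻¹ : ℝ) : ℂ) • u'‖ = 1 := by
    rw [norm_smul, Complex.norm_real, Real.norm_of_nonneg (by positivity),
      inv_mul_cancel₀ hu0'.ne']
  obtain ⟨c, hc, hcu⟩ := hu.eq_smul_of_norm_inner_eq hη hε (hu.ne_zero hp0) hcorner hn'.le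
    (by rw [map_smul, norm_smul, hcorner', Complex.norm_real, Real.norm_of_nonneg (by positivity)]
        field_simp; exact le_rfl)
    (by rw [inner_smul_right, hu'.inner_self_corner hcorner', ← Complex.ofReal_mul,
          Complex.norm_real, Real.norm_of_nonneg (by positivity), ← heq]
        refine le_of_eq ?_
        field_simp)
  -- `u' = r u`, and pairing with `p` shows that `r` is the positive number `‖u'‖ / ‖u‖`
  set r : ℂ := ‖u'‖ * (c / ‖u‖) with hr
  have huc' : (‖u'‖ : ℂ) ≠ 0 := by exact_mod_cast hu0'.ne'
  have hur : u' = r • u := by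
    rw [hr, mul_smul, ← hcu, smul_smul]
    push_cast
    rw [mul_inv_cancel₀ huc', one_smul]
  have hrρ : r = ((‖u'‖ / ‖u‖ : ℝ) : ℂ) := by
    have h1 := hu'.inner_self_corner hcorner'
    rw [hur, inner_smul_right, hu.inner_self_corner hcorner, ← hur] at h1
    have hne : (((ε ^ 2 + η) * ‖u‖ ^ 2 : ℝ) : ℂ) ≠ 0 := by
      have : 0 < (ε ^ 2 + η) * ‖u‖ ^ 2 := by positivity
      exact_mod_cast this.ne'
    rw [← mul_left_inj' hne, h1, ← Complex.ofReal_mul]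
    congr 1
    field_simp
    linarith
  -- comparing the two equations, `u`, and hence `p`, is an eigenvector of `A† A` unless `ρ = 1`
  set ρ : ℝ := ‖u'‖ / ‖u‖ with hρ
  rw [hrρ] at hur
  have hρeq : η - ρ * η' = (ρ - 1) * ε ^ 2 := by
    rw [hρ]
    field_simp
    linarith
  by_cases h1 : ρ = 1
  · rw [h1] at hρeq; linarith
  exfalso
  have hρ1 : ((ρ - 1 : ℝ) : ℂ) ≠ 0 := by exact_mod_cast sub_ne_zero.2 h1
  have heig : adjoint A (A u) = ((ε ^ 2 : ℝ) : ℂ) • u := by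
    have h2 : adjoint A (A u') + (η' : ℂ) • u' = adjoint A (A u) + (η : ℂ) • u := hu'.trans hu.symm
    rw [hur, map_smul, map_smul] at h2
    have h3 : ((ρ - 1 : ℝ) : ℂ) • adjoint A (A u) = ((ρ - 1 : ℝ) : ℂ) • ((ε ^ 2 : ℝ) : ℂ) • u := by
      rw [smul_smul, ← Complex.ofReal_mul, ← hρeq]
      rw [← sub_eq_zero] at h2 ⊢
      rw [← h2]
      push_cast
      module
    exact smul_right_injective E hρ1 h3
  have hpu : p = ((ε ^ 2 + η : ℝ) : ℂ) • u := by
    rw [← hu, heig]; push_cast; module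
  rw [hpu, map_smul, norm_smul, norm_smul, hcorner] at hp
  linarith

/-- If no multiple of `‖A f‖` dominates `|⟪p, f⟫|`, then every ratio `ε` below `‖A p‖ / ‖p‖` is
attained. The ratio `‖A u‖ / ‖u‖` tends to `‖A p‖ / ‖p‖` as `η → ∞`. It cannot stay above `ε` as
`η → 0`: the solutions would stay bounded, and then so would `|⟪p, f⟫| / ‖A f‖`. -/
theorem exists_param (hε : 0 < ε) (hp : ε * ‖p‖ < ‖A p‖)
    (hunb : ∀ C : ℝ, ∃ f, C * ‖A f‖ < ‖inner ℂ p f‖) :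
    ∃ η u, 0 < η ∧ IsTikhonovSolution A p η u ∧ ‖A u‖ = ε * ‖u‖ := by
  have hp0 : 0 < ‖p‖ := by
    rw [norm_pos_iff]; rintro rfl; simp at hp
  choose! U hU using fun (η : ℝ) (hη : 0 < η) => exists_isTikhonovSolution A p hη
  have hcont : ContinuousOn U (Set.Ioi 0) := by
    intro η hη
    have hη' : 0 < η := hη
    refine ContinuousAt.continuousWithinAt ?_
    rw [ContinuousAt, tendsto_iff_norm_sub_tendsto_zero]
    have hlim : Tendsto (fun t : ℝ => |η - t| * ‖U η‖ / t) (𝓝 η) (𝓝 0) := by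
      have : ContinuousAt (fun t : ℝ => |η - t| * ‖U η‖ / t) η :=
        ContinuousAt.div (by fun_prop) continuousAt_id hη'.ne'
      simpa [ContinuousAt] using this
    refine squeeze_zero' (Eventually.of_forall fun _ => norm_nonneg _) ?_ hlim
    filter_upwards [lt_mem_nhds hη'] with t ht
    rw [le_div_iff₀ ht, mul_comm]
    exact (hU t ht).norm_sub_le ht (hU η hη')
  set ψ : ℝ → ℝ := fun η => ‖A (U η)‖ - ε * ‖U η‖ with hψ
  have hψc : ContinuousOn ψ (Set.Ioi 0) :=
    ((A.continuous.comp_continuousOn hcont).norm).sub (hcont.norm.const_mul ε)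
  have hneg : ∃ a, 0 < a ∧ ψ a ≤ 0 := by
    by_contra! hcon
    obtain ⟨f, hf⟩ := hunb (‖A‖ * (‖p‖ / ε ^ 2))
    have hM : ∀ η, 0 < η → ‖U η‖ ≤ ‖p‖ / ε ^ 2 := by
      intro η hη
      have h1 := hcon η hη
      have h2 := (hU η hη).norm_sq_le hη
      have h3 : (ε * ‖U η‖) ^ 2 ≤ ‖A (U η)‖ ^ 2 := by
        gcongr; simp only [hψ] at h1; linarith
      rw [le_div_iff₀ (by positivity)]
      rcases (norm_nonneg (U η)).eq_or_lt with h0 | h0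
      · rw [← h0]; simp
      · nlinarith [sq_nonneg ‖U η‖]
    have hle : ∀ η, 0 < η → ‖inner ℂ p f‖ ≤
        ‖A‖ * (‖p‖ / ε ^ 2) * ‖A f‖ + η * (‖p‖ / ε ^ 2 * ‖f‖) := by
      intro η hη
      refine ((hU η hη).norm_inner_le hη f).trans ?_
      gcongr
      · exact (A.le_opNorm _).trans (by gcongr; exact hM η hη)
      · exact (norm_inner_le_norm _ _).trans (by gcongr; exact hM η hη)
    have hlim : Tendsto (fun η : ℝ => ‖A‖ * (‖p‖ / ε ^ 2) * ‖A f‖ + η * (‖p‖ / ε ^ 2 * ‖f‖))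
        (𝓝[>] 0) (𝓝 (‖A‖ * (‖p‖ / ε ^ 2) * ‖A f‖ + 0 * (‖p‖ / ε ^ 2 * ‖f‖))) :=
      tendsto_nhdsWithin_of_tendsto_nhds ((by fun_prop : Continuous _).tendsto _)
    have := ge_of_tendsto hlim (by filter_upwards [self_mem_nhdsWithin] with η hη using hle η hη)
    linarith
  have hpos : ∃ b, 0 < b ∧ 0 ≤ ψ b := by
    -- `η u_η → p` as `η → ∞`
    have hlim : Tendsto (fun η : ℝ => (η : ℂ) • U η) atTop (𝓝 p) := by
      rw [tendsto_iff_norm_sub_tendsto_zero]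
      have h1 : Tendsto (fun η : ℝ => ‖adjoint A ∘L A‖ * ‖p‖ / η) atTop (𝓝 0) :=
        Tendsto.const_div_atTop tendsto_id _
      refine squeeze_zero' (Eventually.of_forall fun _ => norm_nonneg _) ?_ h1
      filter_upwards [eventually_gt_atTop 0] with η hη
      have h2 : (η : ℂ) • U η - p = -((adjoint A ∘L A) (U η)) := by
        have h3 : adjoint A (A (U η)) + (η : ℂ) • U η = p := hU η hη
        rw [ContinuousLinearMap.comp_apply, eq_sub_of_add_eq' h3]; abel
      rw [h2, norm_neg, le_div_iff₀ hη]
      have h4 := (hU η hη).norm_le hη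
      calc _ ≤ ‖adjoint A ∘L A‖ * ‖U η‖ * η := by
            gcongr; exact ContinuousLinearMap.le_opNorm _ _
        _ ≤ _ := by rw [mul_assoc]; gcongr; linarith
    have h5 : Tendsto (fun η : ℝ => ‖A ((η : ℂ) • U η)‖ - ε * ‖(η : ℂ) • U η‖) atTop
        (𝓝 (‖A p‖ - ε * ‖p‖)) :=
      (((A.continuous.tendsto _).comp hlim).norm).sub (hlim.norm.const_mul ε)
    obtain ⟨b, hb, hb0⟩ := ((h5.eventually_const_lt (show (0 : ℝ) < _ by linarith)).and
      (eventually_gt_atTop 0)).exists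
    refine ⟨b, hb0, ?_⟩
    rw [map_smul, norm_smul, norm_smul, Complex.norm_real, Real.norm_of_nonneg hb0.le] at hb
    simp only [hψ]
    nlinarith
  obtain ⟨a, ha, hψa⟩ := hneg
  obtain ⟨b, hb, hψb⟩ := hpos
  obtain ⟨η, hη, h0⟩ := (isPreconnected_Ioi.image ψ hψc).ordConnected.out
    ⟨a, ha, rfl⟩ ⟨b, hb, rfl⟩ ⟨hψa, hψb⟩
  exact ⟨η, U η, hη, hU η hη, sub_eq_zero.1 h0⟩

end Tikhonov

/-! ### Restriction to the band and the Fredholm equation -/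

instance completeSpace_hardySpace (h : ℝ) : CompleteSpace (hardySpace h) :=
  (isClosed_hardySpace h).completeSpace_coe

/-- Lebesgue measure on `(-1, 1)`. -/
def bandMeasure : Measure ℝ := volume.restrict (Set.Ioo (-1 : ℝ) 1)

instance isFiniteMeasure_bandMeasure : IsFiniteMeasure bandMeasure := by
  unfold bandMeasure; infer_instance

theorem ofReal_mem_halfPlane {h : ℝ} (hh : 0 < h) (x : ℝ) : (x : ℂ) ∈ halfPlane h := by
  simp [halfPlane, hh]

theorem exists_band_bound {h : ℝ} (hh : 0 < h) :
    ∃ C, 0 ≤ C ∧ ∀ g : Lp ℂ 2 (volume : Measure ℝ), ∀ᵐ x : ℝ ∂bandMeasure,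
      ‖cauchyTransform h g (x : ℂ)‖ ≤ C * ‖g‖ := by
  have hc : ContinuousOn (fun x : ℝ => kernelLp h (x : ℂ)) (Set.Icc (-1) 1) :=
    (continuousOn_kernelLp h).comp (by fun_prop) fun x _ => ofReal_mem_halfPlane hh x
  obtain ⟨C, hC⟩ := isCompact_Icc.exists_bound_of_continuousOn hc
  refine ⟨C, (norm_nonneg _).trans (hC 0 (by simp)), fun g => ?_⟩
  filter_upwards [ae_restrict_mem measurableSet_Ioo] with x hx
  refine (norm_inner_le_norm _ _).trans ?_
  gcongr
  exact hC x ⟨hx.1.le, hx.2.le⟩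

theorem memLp_band {h : ℝ} (hh : 0 < h) (g : Lp ℂ 2 (volume : Measure ℝ)) :
    MemLp (fun x : ℝ => cauchyTransform h g (x : ℂ)) 2 bandMeasure := by
  obtain ⟨C, -, hC⟩ := exists_band_bound hh
  refine MemLp.of_bound (Continuous.aestronglyMeasurable ?_) _ (hC g)
  exact ((continuousOn_kernelLp h).comp_continuous Complex.continuous_ofReal
    (ofReal_mem_halfPlane hh)).inner continuous_const

/-- The restriction operator from the Hardy space to `L²(-1, 1)`. -/
def bandOp {h : ℝ} (hh : 0 < h) : hardySpace h →L[ℂ] Lp ℂ 2 bandMeasure :=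
  LinearMap.mkContinuousOfExistsBound
    { toFun := fun g => (memLp_band hh g).toLp
      map_add' := fun g g' => by
        rw [← MemLp.toLp_add]
        exact MemLp.toLp_congr _ _ (Eventually.of_forall fun x => by
          simp [cauchyTransform_add])
      map_smul' := fun c g => by
        rw [RingHom.id_apply, ← MemLp.toLp_const_smul]
        exact MemLp.toLp_congr _ _ (Eventually.of_forall fun x => by
          simp [cauchyTransform_smul]) }
    (by
      obtain ⟨C, hC0, hC⟩ := exists_band_bound hh
      refine ⟨(measureUnivNNReal bandMeasure : ℝ) ^ (2 : ENNReal).toReal⁻¹ * C, fun g => ?_⟩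
      rw [mul_assoc]
      refine Lp.norm_le_of_ae_bound (by positivity) ?_
      filter_upwards [hC g, (memLp_band hh (g : Lp ℂ 2 (volume : Measure ℝ))).coeFn_toLp]
        with x h1 h2
      exact (congrArg norm h2).le.trans h1)

theorem coeFn_bandOp {h : ℝ} (hh : 0 < h) (g : hardySpace h) :
    bandOp hh g =ᵐ[bandMeasure] fun x : ℝ => cauchyTransform h g (x : ℂ) :=
  (memLp_band hh (g : Lp ℂ 2 (volume : Measure ℝ))).coeFn_toLp

section Correspondence

variable {h : ℝ} {f : ℂ → ℂ} {g : hardySpace h}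

theorem memHardy_of_eqOn (hf : Set.EqOn f (cauchyTransform h g) (halfPlane h)) : MemHardy h f :=
  g.2.1.congr hf.symm

theorem hardyNorm_of_eqOn (hf : Set.EqOn f (cauchyTransform h g) (halfPlane h)) :
    hardyNorm h f = ‖g‖ :=
  hardyNorm_eq_norm (memHardy_of_eqOn hf) (tendsto_lineLp_congr hf.symm g.2.2)

theorem bandNorm_of_eqOn (hh : 0 < h)
    (hf : Set.EqOn f (cauchyTransform h g) (halfPlane h)) : bandNorm f = ‖bandOp hh g‖ := by
  rw [Lp.norm_def, bandNorm]
  congr 1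
  refine eLpNorm_congr_ae ?_
  filter_upwards [coeFn_bandOp hh g] with x hx
  rw [hx]
  exact hf (ofReal_mem_halfPlane hh x)

/-- The kernel `p_w` as an element of the Hardy space. -/
def kernelElt {w : ℂ} (hw : w ∈ halfPlane h) : hardySpace h := ⟨kernelLp h w, (kernelLp_mem hw).1⟩

theorem inner_kernelElt (hf : Set.EqOn f (cauchyTransform h g) (halfPlane h))
    {w : ℂ} (hw : w ∈ halfPlane h) : inner ℂ (kernelElt hw) g = f w :=
  (hf hw).symm

theorem conj_kernelFn (h : ℝ) (w : ℂ) (x : ℝ) :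
    (starRingEnd ℂ) (kernelFn h w x) = kernelFn h x w := by
  simp only [kernelFn, map_div₀, map_mul, map_add, map_sub, Complex.conj_I, Complex.conj_ofReal,
    Complex.conj_conj, Complex.conj_ofNat]
  rw [neg_div, ← div_neg]
  congr 1; ring

/-- The operator `𝒦` is the composition of the restriction to `(-1, 1)` with its adjoint. -/
theorem inner_bandOp_kernelElt (hh : 0 < h)
    (hf : Set.EqOn f (cauchyTransform h g) (halfPlane h)) {w : ℂ} (hw : w ∈ halfPlane h) :
    inner ℂ (bandOp hh (kernelElt hw)) (bandOp hh g) = integralOp h f w := by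
  rw [L2.inner_def, integralOp, intervalIntegral.integral_of_le (by norm_num),
    integral_Ioc_eq_integral_Ioo]
  refine integral_congr_ae ?_
  filter_upwards [coeFn_bandOp hh g, coeFn_bandOp hh (kernelElt hw)] with x h1 h2
  have hx := ofReal_mem_halfPlane hh x
  have h3 : cauchyTransform h (kernelElt hw : Lp ℂ 2 (volume : Measure ℝ)) x = kernelFn h w x :=
    ((kernelLp_mem hw).2 hx).symm
  rw [h1, h2, h3, ← hf hx, RCLike.inner_apply, conj_kernelFn, mul_comm]

/-- The Fredholm equation is the regularized normal equation for the restriction operator, tested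
against the reproducing kernels. -/
theorem isFredholmSolution_iff (hh : 0 < h) {ω₀ : ℂ} (hω₀ : ω₀ ∈ halfPlane h) (η : ℝ)
    (hf : Set.EqOn f (cauchyTransform h g) (halfPlane h)) :
    IsFredholmSolution h ω₀ η f ↔ IsTikhonovSolution (bandOp hh) (kernelElt hω₀) η g := by
  have key : ∀ w (hw : w ∈ halfPlane h), inner ℂ (kernelElt hw)
      (ContinuousLinearMap.adjoint (bandOp hh) (bandOp hh g) + (η : ℂ) • g - kernelElt hω₀) =
      integralOp h f w + η * f w - kernelFn h ω₀ w := by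
    intro w hw
    have hsmul : inner ℂ (kernelElt hw) ((η : ℂ) • g) = η * inner ℂ (kernelElt hw) g :=
      inner_smul_right (𝕜 := ℂ) (E := hardySpace h) (kernelElt hw) g (η : ℂ)
    rw [inner_sub_right, inner_add_right, ContinuousLinearMap.adjoint_inner_right,
      inner_bandOp_kernelElt hh hf hw, hsmul, inner_kernelElt hf hw,
      inner_kernelElt (g := kernelElt hω₀) (kernelLp_mem hω₀).2 hw]
  constructor
  · rintro ⟨-, hsol⟩
    refine sub_eq_zero.1 (Subtype.ext (eq_zero_of_cauchyTransform (Subtype.prop _) fun w hw => ?_))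
    have h1 := key w hw
    rw [hsol w hw, sub_self] at h1
    exact h1
  · intro hsol
    refine ⟨memHardy_of_eqOn hf, fun w hw => ?_⟩
    have h1 := key w hw
    rw [sub_eq_zero.2 hsol, inner_zero_right] at h1
    exact sub_eq_zero.1 h1.symm

theorem MemHardy.exists_eqOn (hf : MemHardy h f) :
    ∃ g : hardySpace h, Set.EqOn f (cauchyTransform h g) (halfPlane h) := by
  obtain ⟨g, hg, -, he⟩ := hf.exists_hardySpace
  exact ⟨⟨g, hg⟩, he⟩

end Correspondence

theorem kernelFn_self_ne_zero {h : ℝ} (hh : 0 < h) (ω₀ : ℝ) : kernelFn h ω₀ ω₀ ≠ 0 := by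
  have : (h : ℂ) ≠ 0 := by exact_mod_cast hh.ne'
  have hpi : (Real.pi : ℂ) ≠ 0 := by exact_mod_cast Real.pi_ne_zero
  simp [kernelFn, this, hpi]

theorem kernelElt_ne_zero {h : ℝ} (hh : 0 < h) (ω₀ : ℝ) :
    kernelElt (ofReal_mem_halfPlane hh ω₀) ≠ 0 := by
  intro h0
  have h1 := inner_kernelElt (g := kernelElt (ofReal_mem_halfPlane hh ω₀))
    (kernelLp_mem (ofReal_mem_halfPlane hh ω₀)).2
    (ofReal_mem_halfPlane hh ω₀)
  refine kernelFn_self_ne_zero hh ω₀ (h1.symm.trans ?_)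
  rw [h0, inner_zero_left]

theorem MemHardy.mul_bounded {h : ℝ} {f b : ℂ → ℂ} (hf : MemHardy h f)
    (hb : DifferentiableOn ℂ b (halfPlane h)) {C : ℝ} (hC : ∀ z ∈ halfPlane h, ‖b z‖ ≤ C) :
    MemHardy h (fun z => b z * f z) := by
  obtain ⟨M, hM, hMb⟩ := hf.exists_bound
  refine memHardy_of_bound (hb.mul hf.1) (ENNReal.mul_ne_top (a := ENNReal.ofReal C) (by simp) hM)
    fun y hy => ?_
  refine (eLpNorm_le_mul_eLpNorm_of_ae_le_mul (g := lineRestrict f y)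
    (Eventually.of_forall fun s => ?_) 2).trans (by gcongr; exact hMb y hy)
  have hs : (s : ℂ) + (y : ℂ) * Complex.I ∈ halfPlane h := by simpa [halfPlane] using hy
  simp only [lineRestrict, norm_mul]
  gcongr
  exact hC _ hs

theorem norm_kernelFn (h ω₀ : ℝ) (z : ℂ) :
    ‖kernelFn h ω₀ z‖ = (2 * Real.pi * ‖z - ω₀ + 2 * Complex.I * h‖)⁻¹ := by
  rw [kernelFn, norm_div, Complex.norm_I, norm_mul, norm_mul, Complex.conj_ofReal]
  simp [abs_of_pos Real.pi_pos]

/-- The functions `p_{ω₀} ^ (n + 1)` show that the value at `ω₀ > 1` is not controlled by the norm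
on `(-1, 1)`: on the real line `|p_{ω₀}|` has a strict maximum at `ω₀`. -/
theorem exists_band_small {h ω₀ : ℝ} (hh : 0 < h) (hω₀ : 1 < ω₀) (C : ℝ) :
    ∃ g : hardySpace h, C * ‖bandOp hh g‖ <
      ‖inner ℂ (kernelElt (ofReal_mem_halfPlane hh ω₀)) g‖ := by
  have hmem := ofReal_mem_halfPlane hh ω₀
  have hk := memHardy_kernelFn hmem
  have hkb : ∀ z ∈ halfPlane h, ‖kernelFn h ω₀ z‖ ≤ (2 * Real.pi * h)⁻¹ := by
    intro z hz
    have hz' : -h < z.im := hz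
    rw [norm_kernelFn]
    have h1 := Complex.abs_im_le_norm (z - ω₀ + 2 * Complex.I * h)
    have h2 : (z - ω₀ + 2 * Complex.I * h).im = z.im + 2 * h := by simp
    rw [h2, abs_of_pos (by linarith)] at h1
    have := Real.pi_pos
    gcongr
    linarith
  have hpow : ∀ n : ℕ, MemHardy h (fun z => kernelFn h ω₀ z ^ n * kernelFn h ω₀ z) := fun n =>
    hk.mul_bounded (hk.1.pow n) (C := ((2 * Real.pi * h)⁻¹) ^ n) fun z hz => by
      rw [norm_pow]; gcongr; exact hkb z hz
  set s : ℝ := ‖kernelFn h ω₀ ω₀‖ with hs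
  have hs0 : 0 < s := norm_pos_iff.2 (kernelFn_self_ne_zero hh ω₀)
  set L : ℝ := Real.sqrt ((ω₀ - 1) ^ 2 + (2 * h) ^ 2) with hL
  have hLh : 2 * h < L := by
    rw [hL]
    refine Real.lt_sqrt_of_sq_lt ?_
    have : 0 < (ω₀ - 1) ^ 2 := by have : 0 < ω₀ - 1 := by linarith
                                  positivity
    linarith
  have hsv : s = (2 * Real.pi * (2 * h))⁻¹ := by
    rw [hs, norm_kernelFn]
    simp [abs_of_pos hh]
  set q : ℝ := 2 * h / L with hq
  have hL0 : 0 < L := by linarith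
  have hq0 : 0 ≤ q := by positivity
  have hq1 : q < 1 := (div_lt_one hL0).2 hLh
  have hband : ∀ x : ℝ, x ∈ Set.Ioo (-1 : ℝ) 1 → ‖kernelFn h ω₀ (x : ℂ)‖ ≤ q * s := by
    intro x hx
    have h1 : L ≤ ‖(x : ℂ) - ω₀ + 2 * Complex.I * h‖ := by
      rw [hL]
      refine Real.sqrt_le_iff.2 ⟨norm_nonneg _, ?_⟩
      rw [← Complex.normSq_eq_norm_sq, Complex.normSq_apply]
      simp
      nlinarith [hx.2]
    rw [norm_kernelFn, hsv, hq]
    have := Real.pi_pos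
    have h2 : 2 * h / L * (2 * Real.pi * (2 * h))⁻¹ = (2 * Real.pi * L)⁻¹ := by
      field_simp
    rw [h2]
    gcongr
  set K : ℝ := (measureUnivNNReal bandMeasure : ℝ) ^ (2 : ENNReal).toReal⁻¹ with hK
  have hK0 : 0 ≤ K := by positivity
  obtain ⟨n, hn⟩ := exists_pow_lt_of_lt_one (show 0 < (|C| * K + 1)⁻¹ by positivity) hq1
  obtain ⟨g, hg⟩ := (hpow n).exists_eqOn
  refine ⟨g, ?_⟩
  rw [inner_kernelElt hg hmem, norm_mul, norm_pow, ← hs, ← pow_succ]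
  have hA : ‖bandOp hh g‖ ≤ K * (q * s) ^ (n + 1) := by
    refine Lp.norm_le_of_ae_bound (by positivity) ?_
    filter_upwards [coeFn_bandOp hh g, ae_restrict_mem measurableSet_Ioo] with x h1 h2
    rw [h1, ← hg (ofReal_mem_halfPlane hh x)]
    simp only
    rw [← pow_succ, norm_pow]
    gcongr
    exact hband x h2
  have hqn : q ^ (n + 1) * (|C| * K) < 1 := by
    have h1 : q ^ (n + 1) ≤ q ^ n := pow_le_pow_of_le_one hq0 hq1.le (Nat.le_succ n)
    have h2 : 0 ≤ |C| * K := by positivity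
    rw [← one_div, lt_div_iff₀ (by positivity)] at hn
    nlinarith [pow_nonneg hq0 n]
  calc C * ‖bandOp hh g‖ ≤ |C| * (K * (q * s) ^ (n + 1)) := by
        gcongr; exact le_abs_self C
    _ = q ^ (n + 1) * (|C| * K) * s ^ (n + 1) := by rw [mul_pow]; ring
    _ < 1 * s ^ (n + 1) := by gcongr
    _ = _ := one_mul _

end HardyExtrapolation

end

open HardyExtrapolation in
theorem theorem5p4 (h ω₀ ε : ℝ) (hh : 0 < h) (hω₀ : 1 < ω₀) (hε : 0 < ε) :
    -- `(𝒦 + η)⁻¹ p_{ω₀}` is well defined in `H²(ℍ_h)` for every `η > 0`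
    (∀ η : ℝ, 0 < η → ∃ u : ℂ → ℂ, IsFredholmSolution h (ω₀ : ℂ) η u ∧
      ∀ v : ℂ → ℂ, IsFredholmSolution h (ω₀ : ℂ) η v → Set.EqOn v u (halfPlane h)) ∧
    -- existence and uniqueness of `η(ε)`
    (ε < bandNorm (kernelFn h (ω₀ : ℂ)) / hardyNorm h (kernelFn h (ω₀ : ℂ)) →
      ∃! η : ℝ, 0 < η ∧ ∃ u : ℂ → ℂ, IsFredholmSolution h (ω₀ : ℂ) η u ∧
        bandNorm u = ε * hardyNorm h u) ∧
    -- the sharp bound and the maximizer, which is unique up to a constant phase factor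
    (∀ (η : ℝ) (u : ℂ → ℂ), 0 < η → IsFredholmSolution h (ω₀ : ℂ) η u →
      bandNorm u = ε * hardyNorm h u →
        0 < hardyNorm h u ∧
        (sharpBound h (ω₀ : ℂ) ε : ℂ) = u (ω₀ : ℂ) / (hardyNorm h u : ℂ) ∧
        IsMaximizer h (ω₀ : ℂ) ε (fun z => u z / (hardyNorm h u : ℂ)) ∧
        ∀ g : ℂ → ℂ, IsMaximizer h (ω₀ : ℂ) ε g →
          ∃ c : ℂ, ‖c‖ = 1 ∧
            Set.EqOn g (fun z => c * (u z / (hardyNorm h u : ℂ))) (halfPlane h)) := by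
  have hmem := ofReal_mem_halfPlane hh ω₀
  have hp0 := kernelElt_ne_zero hh ω₀
  have hkp := (kernelLp_mem hmem).2
  refine ⟨fun η hη => ?_, fun hlt => ?_, fun η u hη hu hcorner => ?_⟩
  · obtain ⟨g, hg⟩ := exists_isTikhonovSolution (bandOp hh) (kernelElt hmem) hη
    refine ⟨cauchyTransform h g, (isFredholmSolution_iff hh hmem η fun _ _ => rfl).2 hg,
      fun v hv => ?_⟩
    obtain ⟨g', hg'⟩ := hv.1.exists_eqOn
    have := ((isFredholmSolution_iff hh hmem η hg').1 hv).unique hη hg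
    rwa [this] at hg'
  · rw [hardyNorm_of_eqOn (g := kernelElt hmem) hkp, bandNorm_of_eqOn (g := kernelElt hmem) hh hkp,
      lt_div_iff₀ (norm_pos_iff.2 hp0)] at hlt
    obtain ⟨η, g, hη, hg, hc⟩ := exists_param hε hlt (exists_band_small hh hω₀)
    refine ⟨η, ⟨hη, cauchyTransform h g, (isFredholmSolution_iff hh hmem η fun _ _ => rfl).2 hg, ?_⟩,
      ?_⟩
    · rw [bandNorm_of_eqOn hh fun _ _ => rfl, hardyNorm_of_eqOn fun _ _ => rfl, hc]
    · rintro η' ⟨hη', u', hu', hc'⟩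
      obtain ⟨g', hg'⟩ := hu'.1.exists_eqOn
      rw [bandNorm_of_eqOn hh hg', hardyNorm_of_eqOn hg'] at hc'
      exact ((isFredholmSolution_iff hh hmem η' hg').1 hu').param_unique hη' hη hε.le hlt hc' hg hc
  · obtain ⟨g, hg⟩ := hu.1.exists_eqOn
    have hsol := (isFredholmSolution_iff hh hmem η hg).1 hu
    rw [bandNorm_of_eqOn hh hg, hardyNorm_of_eqOn hg] at hcorner
    rw [hardyNorm_of_eqOn hg]
    have hg0 := hsol.ne_zero hp0
    have hpos : 0 < ‖g‖ := norm_pos_iff.2 hg0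
    have hgc : (‖g‖ : ℂ) ≠ 0 := by exact_mod_cast hpos.ne'
    have hval : u ω₀ = (((ε ^ 2 + η) * ‖g‖ ^ 2 : ℝ) : ℂ) := by
      rw [← hsol.inner_self_corner hcorner, inner_kernelElt hg hmem]
    have hquot : u ω₀ / (‖g‖ : ℂ) = (((ε ^ 2 + η) * ‖g‖ : ℝ) : ℂ) := by
      rw [hval]; push_cast; field_simp
    have hle : ∀ f, Admissible h ε f → ‖f ω₀‖ ≤ (ε ^ 2 + η) * ‖g‖ := by
      rintro f ⟨hf, hf1, hf2⟩
      obtain ⟨g', hg'⟩ := hf.exists_eqOn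
      rw [hardyNorm_of_eqOn hg'] at hf1
      rw [bandNorm_of_eqOn hh hg'] at hf2
      rw [← inner_kernelElt hg' hmem]
      exact hsol.norm_inner_le_max hη hε.le hcorner hf1 hf2
    have hnorm : ‖u ω₀ / (‖g‖ : ℂ)‖ = (ε ^ 2 + η) * ‖g‖ := by
      rw [hquot, Complex.norm_real, Real.norm_of_nonneg (by positivity)]
    have heq : Set.EqOn (fun z => u z / (‖g‖ : ℂ))
        (cauchyTransform h ((((‖g‖⁻¹ : ℝ) : ℂ) • g : hardySpace h))) (halfPlane h) := by
      intro z hz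
      simp only [Submodule.coe_smul, cauchyTransform_smul, Pi.smul_apply, ← hg hz, smul_eq_mul]
      push_cast
      rw [div_eq_inv_mul]
    have hgn : ‖((‖g‖⁻¹ : ℝ) : ℂ)‖ = ‖g‖⁻¹ := by
      rw [Complex.norm_real, Real.norm_of_nonneg (by positivity)]
    have hadm : Admissible h ε (fun z => u z / (‖g‖ : ℂ)) := by
      refine ⟨memHardy_of_eqOn heq, ?_, ?_⟩
      · rw [hardyNorm_of_eqOn heq, norm_smul, hgn, inv_mul_cancel₀ hpos.ne']
      · rw [bandNorm_of_eqOn hh heq, map_smul, norm_smul, hgn, hcorner]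
        field_simp
        exact le_rfl
    refine ⟨hpos, ?_, ⟨hadm, fun f hf => (hle f hf).trans hnorm.ge⟩, fun f hf => ?_⟩
    · have hgr : IsGreatest {r : ℝ | ∃ f : ℂ → ℂ, Admissible h ε f ∧ r = ‖f ω₀‖}
          ((ε ^ 2 + η) * ‖g‖) :=
        ⟨⟨_, hadm, hnorm.symm⟩, by rintro _ ⟨f, hf, rfl⟩; exact hle f hf⟩
      rw [sharpBound, hgr.csSup_eq, hquot]
    · obtain ⟨⟨hfm, hf1, hf2⟩, hmax⟩ := hf
      have hge := hnorm.ge.trans (hmax _ hadm)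
      obtain ⟨g', hg'⟩ := hfm.exists_eqOn
      rw [hardyNorm_of_eqOn hg'] at hf1
      rw [bandNorm_of_eqOn hh hg'] at hf2
      rw [← inner_kernelElt hg' hmem] at hge
      obtain ⟨c, hc, hcg⟩ := hsol.eq_smul_of_norm_inner_eq hη hε.le hg0 hcorner hf1 hf2 hge
      refine ⟨c, hc, fun z hz => ?_⟩
      rw [hg' hz, hcg, Submodule.coe_smul, cauchyTransform_smul, Pi.smul_apply, ← hg hz,
        smul_eq_mul]
      ring
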